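/- Let $n\ge 1$ and let all matrices be complex. For $n\times n$ matrices $A,B$ let $X_A(M)=AM$ and $\Delta_B(M)=B\circ M$ (entrywise product) be the corresponding operators on $n\times n$ matrices. The pair $(A,B)$ is a one-sided Jones pair if $X_A$ and $\Delta_B$ are invertible and $X_A\Delta_BX_A=\Delta_BX_A\Delta_B$; it is a Jones pair if $(A,B)$ and $(A,B^T)$ are both one-sided Jones pairs; a Jones pair is invertible if in addition $A$ has no zero entry and $B$ is an invertible matrix. For a matrix $A$ without zero entries, $A^{(-)}$ denotes its entrywise inverse. Let $\mathcal N_{A,B}$ be the space of matrices $M$ having every vector $Ae_i\circ Be_j$ as an eigenvector, let $T_{A,B}(M)$ be the matrix whose $(i,j)$ entry is the eigenvalue of $M$ on $Ae_i\circ Be_j$, and put $\mathcal N_A=\mathcal N_{A,A^{(-)}}$, $\Theta_A=T_{A,A^{(-)}}$. Let $(A,B)$ be an invertible Jones pair of $n\times n$ matrices with $A$ symmetric, let $d^2=n$, and let $$V=\begin{pmatrix} dA&-dA&B^{(-)}&B^{(-)}\\ -dA&dA&B^{(-)}&B^{(-)}\\ (B^{(-)})^T&(B^{(-)})^T&dA&-dA\\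 (B^{(-)})^T&(B^{(-)})^T&-dA&dA\end{pmatrix}.$$ Let $\widehat S$ be the set of all $4n\times4n$ matrices $$\begin{pmatrix} F+R&F-R&0&0\\ F-R&F+R&0&0\\ 0&0&B^{-1}FB+R_1&B^{-1}FB-R_1\\ 0&0&B^{-1}FB-R_1&B^{-1}FB+R_1\end{pmatrix}$$ with $F\in\mathcal N_A$, $R\in\mathcal N_{A,B}$ and $\Theta_{B^T}(A\circ R_1)^T=\Theta_A(A\circ R)$ (where it is understood that $A\circ R_1\in\mathcal N_{B^T}$ and $A\circ R\in\mathcal N_A$), and let $$\widehat J=\begin{pmatrix}0&0&J_n&J_n\\0&0&J_n&J_n\\J_n&J_n&0&0\\J_n&J_n&0&0\end{pmatrix},$$ where $J_n$ is the $n\times n$ all-ones matrix. Then the linear span $\mathcal B'$ of $\widehat S\cup\{\widehat J\}$ is a Bose–Mesner algebra, that is, the span of the adjacency matrices of a commutative association scheme on $4n$ points, and $\mathcal B'\subseteq\mathcal N_V$. If $r=\dim\mathcal N_A$, then $\dim\mathcal B'=2r+1$. -/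

import Mathlib

namespace JonesPair

open Matrix

noncomputable section

variable {ι : Type*}

/-- The entrywise (Schur) inverse `A⁽⁻⁾` of a matrix. -/
def schurInv (A : Matrix ι ι ℂ) : Matrix ι ι ℂ :=
  A.map fun x => x⁻¹

/-- The all-ones matrix. -/
def allOnes (ι : Type*) : Matrix ι ι ℂ :=
  Matrix.of fun _ _ => 1

/-- The operator `X_A : M ↦ A M` on square matrices. -/
def opX [Fintype ι] [DecidableEq ι] (A : Matrix ι ι ℂ) : Module.End ℂ (Matrix ι ι ℂ) :=
  LinearMap.mulLeft ℂ A

/-- The operator `Δ_B : M ↦ B ∘ M` (entrywise product) on square matrices. -/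
def opDelta (B : Matrix ι ι ℂ) : Module.End ℂ (Matrix ι ι ℂ) where
  toFun M := B ⊙ M
  map_add' M N := Matrix.hadamard_add B M N
  map_smul' c M := Matrix.hadamard_smul B M c

/-- `(A, B)` is a one-sided Jones pair: `X_A` and `Δ_B` are invertible and
`X_A Δ_B X_A = Δ_B X_A Δ_B`. -/
structure IsOneSidedJonesPair [Fintype ι] [DecidableEq ι] (A B : Matrix ι ι ℂ) : Prop where
  isUnit_opX : IsUnit (opX A)
  isUnit_opDelta : IsUnit (opDelta B)
  braid : opX A * opDelta B * opX A = opDelta B * opX A * opDelta B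

/-- `(A, B)` is a Jones pair: both `(A, B)` and `(A, Bᵀ)` are one-sided Jones pairs. -/
def IsJonesPair [Fintype ι] [DecidableEq ι] (A B : Matrix ι ι ℂ) : Prop :=
  IsOneSidedJonesPair A B ∧ IsOneSidedJonesPair A Bᵀ

/-- A Jones pair `(A, B)` is invertible if `A` has no zero entry and `B` is an invertible
matrix. -/
structure IsInvertibleJonesPair [Fintype ι] [DecidableEq ι] (A B : Matrix ι ι ℂ) : Prop where
  isJonesPair : IsJonesPair A B
  schurInvertible : ∀ i j, A i j ≠ 0
  isUnit : IsUnit B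

/-- The vector `A e_i ∘ B e_j`: entrywise product of column `i` of `A` and column `j` of `B`. -/
def evec (A B : Matrix ι ι ℂ) (i j : ι) : ι → ℂ :=
  fun k => A k i * B k j

/-- The space `N_{A,B}` of all matrices having every vector `A e_i ∘ B e_j` as an
eigenvector. -/
def nomuraPair [Fintype ι] (A B : Matrix ι ι ℂ) : Submodule ℂ (Matrix ι ι ℂ) where
  carrier := {M | ∀ i j, ∃ c : ℂ, M *ᵥ evec A B i j = c • evec A B i j}
  zero_mem' := fun _ _ => ⟨0, by simp⟩
  add_mem' := by
    intro M N hM hN i j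
    obtain ⟨c, hc⟩ := hM i j
    obtain ⟨e, he⟩ := hN i j
    exact ⟨c + e, by rw [Matrix.add_mulVec, hc, he, add_smul]⟩
  smul_mem' := by
    intro a M hM i j
    obtain ⟨c, hc⟩ := hM i j
    exact ⟨a * c, by rw [Matrix.smul_mulVec, hc, smul_smul]⟩

open Classical in
/-- The matrix `T_{A,B}(M)` of eigenvalues: for `M ∈ N_{A,B}`, its `(i, j)` entry is the
eigenvalue of `M` on `A e_i ∘ B e_j` (unique when that vector is nonzero). -/
def eigMatrix [Fintype ι] (A B M : Matrix ι ι ℂ) : Matrix ι ι ℂ :=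
  Matrix.of fun i j =>
    if h : ∃ c : ℂ, M *ᵥ evec A B i j = c • evec A B i j then h.choose else 0

/-- The Nomura algebra `N_A = N_{A, A⁽⁻⁾}`. -/
def nomura [Fintype ι] (A : Matrix ι ι ℂ) : Submodule ℂ (Matrix ι ι ℂ) :=
  nomuraPair A (schurInv A)

/-- The duality map `Θ_A = T_{A, A⁽⁻⁾}`. -/
def theta [Fintype ι] (A M : Matrix ι ι ℂ) : Matrix ι ι ℂ :=
  eigMatrix A (schurInv A) M

/-- The index set of the four groups of rows and columns of a `4n × 4n` matrix. -/
abbrev Four (ι : Type*) : Type _ := (ι ⊕ ι) ⊕ (ι ⊕ ι)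

/-- The `4n × 4n` matrix
```
 dA    -dA   B⁽⁻⁾   B⁽⁻⁾
-dA     dA   B⁽⁻⁾   B⁽⁻⁾
B⁽⁻⁾ᵀ  B⁽⁻⁾ᵀ   dA    -dA
B⁽⁻⁾ᵀ  B⁽⁻⁾ᵀ  -dA     dA
```
-/
def matV (d : ℂ) (A B : Matrix ι ι ℂ) : Matrix (Four ι) (Four ι) ℂ :=
  fromBlocks
    (fromBlocks (d • A) (-(d • A)) (-(d • A)) (d • A))
    (fromBlocks (schurInv B) (schurInv B) (schurInv B) (schurInv B))
    (fromBlocks (schurInv B)ᵀ (schurInv B)ᵀ (schurInv B)ᵀ (schurInv B)ᵀ)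
    (fromBlocks (d • A) (-(d • A)) (-(d • A)) (d • A))

/-- The block-diagonal `4n × 4n` matrix
```
F+R   F-R    0     0
F-R   F+R    0     0
 0     0    G+R₁  G-R₁
 0     0    G-R₁  G+R₁
```
-/
def blockMatrix (F R G R₁ : Matrix ι ι ℂ) : Matrix (Four ι) (Four ι) ℂ :=
  fromBlocks
    (fromBlocks (F + R) (F - R) (F - R) (F + R)) 0
    0 (fromBlocks (G + R₁) (G - R₁) (G - R₁) (G + R₁))

/-- The set `Ŝ` of the block-diagonal matrices with `F ∈ N_A`, `R ∈ N_{A,B}`, `G = B⁻¹FB` and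
`Θ_{Bᵀ}(A ∘ R₁)ᵀ = Θ_A(A ∘ R)`; the last equation includes that both arguments lie in the
domains `N_{Bᵀ}` and `N_A` of the two maps. -/
def hatS [Fintype ι] [DecidableEq ι] (A B : Matrix ι ι ℂ) : Set (Matrix (Four ι) (Four ι) ℂ) :=
  {Z | ∃ F R R₁ : Matrix ι ι ℂ,
    F ∈ nomura A ∧ R ∈ nomuraPair A B ∧
    A ⊙ R₁ ∈ nomura Bᵀ ∧ A ⊙ R ∈ nomura A ∧
    (theta Bᵀ (A ⊙ R₁))ᵀ = theta A (A ⊙ R) ∧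
    Z = blockMatrix F R (B⁻¹ * F * B) R₁}

/-- The matrix `Ĵ`, with zero diagonal and all-ones off-diagonal `2n × 2n` blocks. -/
def hatJ (ι : Type*) : Matrix (Four ι) (Four ι) ℂ :=
  fromBlocks 0 (allOnes (ι ⊕ ι)) (allOnes (ι ⊕ ι)) 0

/-- The span of `Ŝ ∪ {Ĵ}`. -/
def spanHat [Fintype ι] [DecidableEq ι] (A B : Matrix ι ι ℂ) :
    Submodule ℂ (Matrix (Four ι) (Four ι) ℂ) :=
  Submodule.span ℂ (hatS A B ∪ {hatJ ι})

/-- `E 0, …, E m` are the adjacency matrices of a (commutative) association scheme with `m`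
classes. -/
structure IsAssociationScheme {κ : Type*} [Fintype κ] [DecidableEq κ] {m : ℕ}
    (E : Fin (m + 1) → Matrix κ κ ℂ) : Prop where
  zero_or_one : ∀ k x y, E k x y = 0 ∨ E k x y = 1
  ne_zero : ∀ k, E k ≠ 0
  zero_eq_one : E 0 = 1
  sum_eq : ∑ k, E k = allOnes κ
  transpose_mem : ∀ k, ∃ l, (E k)ᵀ = E l
  mul_mem : ∀ k l, E k * E l ∈ Submodule.span ℂ (Set.range E)
  mul_comm : ∀ k l, E k * E l = E l * E k

/-- A Bose–Mesner algebra: the span of the adjacency matrices of an association scheme. -/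
def IsBoseMesnerAlgebra {κ : Type*} [Fintype κ] [DecidableEq κ]
    (𝓑 : Submodule ℂ (Matrix κ κ ℂ)) : Prop :=
  ∃ (m : ℕ) (E : Fin (m + 1) → Matrix κ κ ℂ),
    IsAssociationScheme E ∧ 𝓑 = Submodule.span ℂ (Set.range E)

end

end JonesPair

/-! ### Type II matrices and matrices of eigenvalues. -/

namespace JonesPair

open Matrix

variable {ι : Type*} [Fintype ι]

/-! On vectors `(f, f)` a block `F+R, F-R, F-R, F+R` acts as `2F`, and on `(f, -f)` as `2R`. The
entrywise quotient of two columns of `V` from the same half has the first shape in both halves of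
its coordinates, with parts that are eigenvectors for `N_A`, `N_B` or `N_{Bᵀ}`. For columns from
different halves it has the second shape, with parts that are eigenvectors for spaces such as
`N_{A,B}`. So a block matrix lies in `N_V` once the eigenvalues of its two diagonal blocks match.
This matching is recorded by `EvenPair` for `(F, G)` and `OddPair` for `(R, R₁)`, and `mem_hatS_iff`
shows that `Ŝ` consists exactly of the matrices built from such pairs.

An invertible Jones pair consists of type II matrices (`IsInvertibleJonesPair.isTypeII`), and `A`
has eigenvalue `B i j` on `A e_i ∘ B e_j`. From this come two structural facts. Conjugation by `B`
carries `N_A` into `N_{Bᵀ}` and transposes eigenvalue matrices (`eig_conj`), so `F` determines `G`.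
Entrywise multiplication by `A` turns odd pairs into even ones and back (`oddPair_iff`). Hence `F`
and `A ∘ R` range freely over `N_A`, and with `Ĵ` the dimension is `2r + 1`.

The span is closed under the ordinary product because both kinds of pairs are. For the entrywise
product the pairs behave like a grading modulo 2; the case odd times odd needs `A⁽⁻⁾ ∘ A⁽⁻⁾` to be
even (`evenPair_schurInv`). The matrix `Ĵ` supplies the all-ones matrix. A commutative space
containing `I` and `J` and closed under both products and transposition is a Bose–Mesner algebra
(`isBoseMesnerAlgebra_of_closed`). -/

theorem schurInv_apply {ι : Type*} (A : Matrix ι ι ℂ) (i j : ι) :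
    schurInv A i j = (A i j)⁻¹ := rfl

theorem schurInv_schurInv {ι : Type*} (A : Matrix ι ι ℂ) : schurInv (schurInv A) = A := by
  ext i j; simp [schurInv_apply]

theorem schurInv_transpose {ι : Type*} (A : Matrix ι ι ℂ) : schurInv Aᵀ = (schurInv A)ᵀ := rfl

/-- `S` is a matrix of eigenvalues of `M` on the vectors `A e_i ∘ B e_j`. -/
def IsEigMatrix (A B M S : Matrix ι ι ℂ) : Prop :=
  ∀ i j y, ∑ z, M y z * (A z i * B z j) = S i j * (A y i * B y j)

theorem isEigMatrix_iff_mulVec {A B M S : Matrix ι ι ℂ} :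
    IsEigMatrix A B M S ↔ ∀ i j, M *ᵥ evec A B i j = S i j • evec A B i j := by
  refine forall₂_congr fun i j => ?_
  rw [funext_iff]
  rfl

theorem mem_nomuraPair_iff {A B M : Matrix ι ι ℂ} :
    M ∈ nomuraPair A B ↔ ∃ S, IsEigMatrix A B M S := by
  constructor
  · intro h
    choose S hS using h
    exact ⟨Matrix.of S, isEigMatrix_iff_mulVec.2 hS⟩
  · rintro ⟨S, hS⟩ i j
    exact ⟨S i j, isEigMatrix_iff_mulVec.1 hS i j⟩

theorem card_cast_ne_zero [Nonempty ι] : (Fintype.card ι : ℂ) ≠ 0 :=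
  Nat.cast_ne_zero.2 Fintype.card_ne_zero

/-- A type-II matrix: no zero entries and `A A⁽⁻⁾ᵀ = n I`. -/
structure IsTypeII [DecidableEq ι] (A : Matrix ι ι ℂ) : Prop where
  ne_zero : ∀ i j, A i j ≠ 0
  mul_eq : A * (schurInv A)ᵀ = (Fintype.card ι : ℂ) • 1

namespace IsEigMatrix

variable {A B M N S T : Matrix ι ι ℂ}

/-- The vectors have no zero entry, so the eigenvalue picked by choice is the only one. -/
theorem eigMatrix_eq [Nonempty ι] (hA : ∀ i j, A i j ≠ 0) (hB : ∀ i j, B i j ≠ 0)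
    (h : IsEigMatrix A B M S) : eigMatrix A B M = S := by
  ext i j
  have hi := isEigMatrix_iff_mulVec.1 h i j
  have hex : ∃ c : ℂ, M *ᵥ evec A B i j = c • evec A B i j := ⟨_, hi⟩
  have h1 : eigMatrix A B M i j = hex.choose := by
    simp only [eigMatrix, Matrix.of_apply]
    exact dif_pos hex
  have h2 := hex.choose_spec
  rw [← h1, hi] at h2
  have h3 := congrFun h2 i
  simp only [Pi.smul_apply, smul_eq_mul, evec] at h3
  exact (mul_right_cancel₀ (mul_ne_zero (hA i i) (hB i j)) h3).symm

theorem swap (h : IsEigMatrix A B M S) : IsEigMatrix B A M Sᵀ := by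
  intro i j y
  have := h j i y
  simp only [Matrix.transpose_apply, mul_comm (B _ i)]
  exact this

theorem add (h : IsEigMatrix A B M S) (h' : IsEigMatrix A B N T) :
    IsEigMatrix A B (M + N) (S + T) := by
  intro i j y
  simp only [Matrix.add_apply, add_mul, Finset.sum_add_distrib, h i j y, h' i j y]

theorem smul (c : ℂ) (h : IsEigMatrix A B M S) : IsEigMatrix A B (c • M) (c • S) := by
  intro i j y
  simp only [Matrix.smul_apply, smul_eq_mul, mul_assoc, ← Finset.mul_sum]
  rw [h i j y]

theorem mul (h : IsEigMatrix A B M S) (h' : IsEigMatrix A B N T) :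
    IsEigMatrix A B (M * N) (S ⊙ T) := by
  rw [isEigMatrix_iff_mulVec] at *
  intro i j
  rw [← Matrix.mulVec_mulVec, h' i j, Matrix.mulVec_smul, h i j, smul_smul,
    Matrix.hadamard_apply, mul_comm]

end IsEigMatrix

theorem isEigMatrix_one [DecidableEq ι] (A B : Matrix ι ι ℂ) :
    IsEigMatrix A B 1 (allOnes ι) := by
  intro i j y
  simp [Matrix.one_apply, allOnes]

theorem isEigMatrix_zero (A B : Matrix ι ι ℂ) : IsEigMatrix A B 0 0 := by
  intro i j y
  simp

variable [DecidableEq ι]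

namespace IsTypeII

variable {A B M N S T : Matrix ι ι ℂ}

theorem sum_row (hA : IsTypeII A) (x z : ι) :
    ∑ i, A x i * (A z i)⁻¹ = if x = z then (Fintype.card ι : ℂ) else 0 := by
  have h := congrFun (congrFun hA.mul_eq x) z
  simpa [Matrix.mul_apply, schurInv_apply, Matrix.one_apply] using h

theorem inv (hA : IsTypeII A) : IsTypeII (schurInv A) where
  ne_zero i j := inv_ne_zero (hA.ne_zero i j)
  mul_eq := by
    have h := congrArg Matrix.transpose hA.mul_eq
    rw [Matrix.transpose_mul, Matrix.transpose_transpose] at h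
    rw [schurInv_schurInv, h]
    simp

/-- Inversion of the linear system with matrix `A`. -/
theorem inversion (hA : IsTypeII A) {f g : ι → ℂ} (h : ∀ i, ∑ z, f z * A z i = g i) (z : ι) :
    ∑ i, g i * (A z i)⁻¹ = Fintype.card ι * f z := by
  simp only [← h, Finset.sum_mul]
  rw [Finset.sum_comm]
  simp only [mul_assoc, ← Finset.mul_sum, hA.sum_row]
  simp [mul_comm]

variable [Nonempty ι]

theorem mul_eq' (hA : IsTypeII A) : (schurInv A)ᵀ * A = (Fintype.card ι : ℂ) • 1 := by
  have h : A * ((Fintype.card ι : ℂ)⁻¹ • (schurInv A)ᵀ) = 1 := by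
    rw [Matrix.mul_smul, hA.mul_eq, smul_smul, inv_mul_cancel₀ card_cast_ne_zero, one_smul]
  rw [mul_eq_one_comm, Matrix.smul_mul] at h
  rw [← h, smul_smul, mul_inv_cancel₀ card_cast_ne_zero, one_smul]

theorem sum_col (hA : IsTypeII A) (i j : ι) :
    ∑ z, A z i * (A z j)⁻¹ = if i = j then (Fintype.card ι : ℂ) else 0 := by
  have h := congrFun (congrFun hA.mul_eq' j) i
  simpa [Matrix.mul_apply, schurInv_apply, Matrix.one_apply, mul_comm, eq_comm] using h

theorem transpose (hA : IsTypeII A) : IsTypeII Aᵀ where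
  ne_zero i j := hA.ne_zero j i
  mul_eq := by
    have h := congrArg Matrix.transpose hA.mul_eq'
    rw [Matrix.transpose_mul, Matrix.transpose_transpose] at h
    rw [schurInv_transpose, Matrix.transpose_transpose, h]
    simp

theorem inversion' (hA : IsTypeII A) {f g : ι → ℂ}
    (h : ∀ z, ∑ i, g i * (A z i)⁻¹ = Fintype.card ι * f z) (i : ι) :
    ∑ z, f z * A z i = g i := by
  have h1 := hA.transpose.inv.inversion (f := g) (g := fun z => Fintype.card ι * f z) h i
  simp only [schurInv_apply, Matrix.transpose_apply, inv_inv, mul_assoc, ← Finset.mul_sum] at h1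
  exact mul_left_cancel₀ card_cast_ne_zero h1

/-- For type-II `A`, the eigenvector equations can be solved for `M`. -/
theorem isEigMatrix_iff (hA : IsTypeII A) :
    IsEigMatrix A B M S ↔
      ∀ j y z, ∑ i, S i j * (A y i * B y j) * (A z i)⁻¹ = Fintype.card ι * (M y z * B z j) := by
  constructor
  · intro h j y z
    refine hA.inversion (f := fun z => M y z * B z j) (g := fun i => S i j * (A y i * B y j)) ?_ z
    intro i
    rw [← h i j y]
    exact Finset.sum_congr rfl fun z _ => by ring
  · intro h i j y
    rw [← hA.inversion' (f := fun z => M y z * B z j) (g := fun i => S i j * (A y i * B y j))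
      (h j y) i]
    exact Finset.sum_congr rfl fun z _ => by ring

theorem isEigMatrix_iff_left (hA : IsTypeII A) (hB : ∀ i j, B i j ≠ 0) :
    IsEigMatrix A B M S ↔
      ∀ j y z, ∑ i, S i j * A y i * (A z i)⁻¹ =
        Fintype.card ι * (M y z * B z j * (B y j)⁻¹) := by
  rw [hA.isEigMatrix_iff]
  refine forall₃_congr fun j y z => ?_
  rw [← mul_left_inj' (inv_ne_zero (hB y j)), Finset.sum_mul]
  have : ∀ i, S i j * (A y i * B y j) * (A z i)⁻¹ * (B y j)⁻¹ = S i j * A y i * (A z i)⁻¹ := by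
    intro i
    have := hB y j
    field_simp
  simp only [this]
  rw [mul_assoc]

/-- A matrix is determined by its eigenvalues on the vectors `A e_i ∘ B e_j`. -/
theorem eq_of_isEigMatrix (hA : IsTypeII A) (hB : ∀ i j, B i j ≠ 0)
    (h : IsEigMatrix A B M S) (h' : IsEigMatrix A B N S) : M = N := by
  ext y z
  have h1 := (hA.isEigMatrix_iff.1 h y y z).symm.trans (hA.isEigMatrix_iff.1 h' y y z)
  exact mul_right_cancel₀ (hB z y) (mul_left_cancel₀ card_cast_ne_zero h1)

theorem commute_of_isEigMatrix (hA : IsTypeII A) (hB : ∀ i j, B i j ≠ 0)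
    (h : IsEigMatrix A B M S) (h' : IsEigMatrix A B N T) : M * N = N * M := by
  refine hA.eq_of_isEigMatrix hB (h.mul h') ?_
  rw [Matrix.hadamard_comm]
  exact h'.mul h

/-- Transposing `M` inverts the eigenvectors entrywise. -/
theorem isEigMatrix_transpose_schurInv (hA : IsTypeII A) (hB : ∀ i j, B i j ≠ 0)
    (h : IsEigMatrix A B M S) :
    IsEigMatrix (schurInv A) (schurInv B) Mᵀ S := by
  intro i j z
  -- Up to conjugation by a diagonal matrix built from column `j` of `B`, `M` equals `A D A⁻¹` with
  -- `D` the diagonal matrix of the `S k j`; its transpose is diagonalised by `A⁽⁻⁾`.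
  have h1 := (hA.isEigMatrix_iff_left hB).1 h j
  simp only [schurInv_apply, Matrix.transpose_apply]
  apply mul_left_cancel₀ (card_cast_ne_zero (ι := ι))
  have h2 : ∀ y, (Fintype.card ι : ℂ) * (M y z * ((A y i)⁻¹ * (B y j)⁻¹)) =
      ∑ k, S k j * A y k * (A z k)⁻¹ * ((B z j)⁻¹ * (A y i)⁻¹) := by
    intro y
    rw [← Finset.sum_mul, h1]
    have := hB z j
    field_simp
  rw [Finset.mul_sum, Finset.sum_congr rfl fun y _ => h2 y, Finset.sum_comm]
  have h3 : ∀ k, ∑ y, S k j * A y k * (A z k)⁻¹ * ((B z j)⁻¹ * (A y i)⁻¹) =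
      S k j * (A z k)⁻¹ * (B z j)⁻¹ * (if k = i then (Fintype.card ι : ℂ) else 0) := by
    intro k
    rw [← hA.sum_col, Finset.mul_sum]
    exact Finset.sum_congr rfl fun y _ => by ring
  simp only [h3]
  simp
  ring

/-- The Nomura algebra is closed under transposition. -/
theorem isEigMatrix_transpose (hA : IsTypeII A)
    (h : IsEigMatrix A (schurInv A) M S) :
    IsEigMatrix A (schurInv A) Mᵀ Sᵀ := by
  have h1 := (hA.isEigMatrix_transpose_schurInv hA.inv.ne_zero h).swap
  rwa [schurInv_schurInv] at h1

/-- Duality of Nomura algebras. -/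
theorem isEigMatrix_dual (hA : IsTypeII A) (h : IsEigMatrix A (schurInv A) M S) :
    IsEigMatrix Aᵀ (schurInv Aᵀ) Sᵀ ((Fintype.card ι : ℂ) • M) := by
  intro y z j
  -- The solved system is itself an eigenvector equation, with `Sᵀ` as the matrix and `n M` as the
  -- eigenvalues.
  have h1 := (hA.isEigMatrix_iff_left hA.inv.ne_zero).1 h j y z
  simp only [schurInv_apply, Matrix.transpose_apply, inv_inv, ← mul_assoc, Matrix.smul_apply,
    smul_eq_mul] at h1 ⊢
  rw [h1]
  ring

/-- The Nomura algebra is closed under the entrywise product. -/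
theorem isEigMatrix_hadamard (hA : IsTypeII A)
    (h : IsEigMatrix A (schurInv A) M S)
    (h' : IsEigMatrix A (schurInv A) N T) :
    IsEigMatrix A (schurInv A) (M ⊙ N) ((Fintype.card ι : ℂ)⁻¹ • (T * S)) := by
  -- Dualising twice returns to `A`: in between, the entrywise product has become the product of
  -- `Sᵀ` and `Tᵀ`.
  have h1 := hA.transpose.isEigMatrix_dual ((hA.isEigMatrix_dual h).mul (hA.isEigMatrix_dual h'))
  simp only [Matrix.transpose_transpose] at h1
  have h2 := (hA.isEigMatrix_transpose h1).smul ((Fintype.card ι : ℂ)⁻¹ ^ 2)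
  have hc := card_cast_ne_zero (ι := ι)
  convert h2 using 1
  · ext i j
    simp only [Matrix.hadamard_apply, Matrix.smul_apply, Matrix.transpose_apply, smul_eq_mul]
    field_simp
  · rw [← Matrix.transpose_mul, Matrix.transpose_smul, Matrix.transpose_transpose, smul_smul]
    congr 1
    field_simp

theorem isEigMatrix_allOnes (hA : IsTypeII A) :
    IsEigMatrix A (schurInv A) (allOnes ι) ((Fintype.card ι : ℂ) • 1) := by
  intro i j y
  simp only [allOnes, Matrix.of_apply, one_mul, schurInv_apply, hA.sum_col, Matrix.smul_apply,
    Matrix.one_apply, smul_eq_mul]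
  split_ifs with hij
  · subst hij
    rw [mul_inv_cancel₀ (hA.ne_zero y i)]; ring
  · ring

end IsTypeII

end JonesPair

/-! ### Symmetric pairs: relations between the spaces attached to `A` and `B`. -/

namespace JonesPair

open Matrix

variable {ι : Type*} [Fintype ι]

/-- Transport of the Nomura algebra of `A` along a matrix that maps its eigenvectors to those of
`C`. -/
theorem IsEigMatrix.transport {A C F G θ X : Matrix ι ι ℂ} {c : ι → ι → ℂ}
    (hF : IsEigMatrix A (schurInv A) F θ) (hc : ∀ x z, c x z ≠ 0)
    (hX : ∀ x z j, ∑ y, X j y * (A y x * (A y z)⁻¹) = c x z * (C j z * (C j x)⁻¹))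
    (hG : G * X = X * F) : IsEigMatrix C (schurInv C) G θᵀ := by
  rw [isEigMatrix_iff_mulVec] at hF ⊢
  intro z x
  have h1 : X *ᵥ evec A (schurInv A) x z = c x z • evec C (schurInv C) z x :=
    funext fun j => hX x z j
  have h2 : evec C (schurInv C) z x = (c x z)⁻¹ • X *ᵥ evec A (schurInv A) x z := by
    rw [h1, smul_smul, inv_mul_cancel₀ (hc x z), one_smul]
  rw [h2, Matrix.mulVec_smul, Matrix.mulVec_mulVec, hG, ← Matrix.mulVec_mulVec, hF,
    Matrix.mulVec_smul, smul_comm, Matrix.transpose_apply]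

variable [DecidableEq ι]

/-- The consequences of `(A, B)` being an invertible Jones pair with `A` symmetric that
determine the algebras attached to it. -/
structure IsSymmPair (A B : Matrix ι ι ℂ) : Prop where
  symm : A.IsSymm
  left : IsTypeII A
  right : IsTypeII B
  eig : IsEigMatrix A B A B
  eig_transpose : IsEigMatrix A Bᵀ A Bᵀ

namespace IsSymmPair

variable {A B F G K M N R R₁ S T θ ρ X : Matrix ι ι ℂ} [Nonempty ι]

theorem transpose (h : IsSymmPair A B) : IsSymmPair A Bᵀ where
  symm := h.symm
  left := h.left
  right := h.right.transpose
  eig := h.eig_transpose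
  eig_transpose := by simpa using h.eig

/-- Since `A` is symmetric and type II, `A⁽⁻⁾ = n A⁻¹`, so the eigenvalues of `A` get inverted and
scaled by `n`. -/
theorem eig_inv (h : IsSymmPair A B) :
    IsEigMatrix A B (schurInv A) ((Fintype.card ι : ℂ) • schurInv B) := by
  intro i j z
  have h1 := h.left.transpose.inversion (f := fun y => A y i * B y j)
    (g := fun x => B i j * (A x i * B x j)) (fun x => by
      rw [← h.eig i j x]
      exact Finset.sum_congr rfl fun y _ => by rw [Matrix.transpose_apply]; ring) z
  simp only [schurInv_apply, Matrix.transpose_apply, Matrix.smul_apply, smul_eq_mul, mul_assoc,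
    ← Finset.mul_sum] at h1 ⊢
  rw [mul_left_comm, ← h1, inv_mul_cancel_left₀ (h.right.ne_zero i j)]
  exact Finset.sum_congr rfl fun y _ => by rw [h.symm.apply]; ring

/-- `Bᵀ` maps the eigenvectors of `N_A` to those of `N_{Bᵀ}`. -/
theorem sum_left (h : IsSymmPair A B) (j y z : ι) :
    ∑ i, B i j * A y i * (A z i)⁻¹ = Fintype.card ι * (A y z * B z j * (B y j)⁻¹) :=
  (h.left.isEigMatrix_iff_left h.right.ne_zero).1 h.eig j y z

theorem sum_left_inv (h : IsSymmPair A B) (j y z : ι) :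
    ∑ i, (B i j)⁻¹ * A y i * (A z i)⁻¹ = (A y z)⁻¹ * B z j * (B y j)⁻¹ := by
  have h1 := (h.left.isEigMatrix_iff_left h.right.ne_zero).1 h.eig_inv j y z
  simp only [schurInv_apply, Matrix.smul_apply, smul_eq_mul, mul_assoc, ← Finset.mul_sum] at h1
  simp only [mul_assoc]
  exact mul_left_cancel₀ card_cast_ne_zero h1

theorem sum_right (h : IsSymmPair A B) (i y z : ι) :
    ∑ j, B i j * B y j * (B z j)⁻¹ = Fintype.card ι * (A y z * A z i * (A y i)⁻¹) := by
  have h1 := (h.right.isEigMatrix_iff_left h.left.ne_zero).1 h.eig.swap i y z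
  simpa only [Matrix.transpose_apply] using h1

theorem sum_right_inv (h : IsSymmPair A B) (i y z : ι) :
    ∑ j, (B i j)⁻¹ * B y j * (B z j)⁻¹ = (A y z)⁻¹ * A z i * (A y i)⁻¹ := by
  have h1 := (h.right.isEigMatrix_iff_left h.left.ne_zero).1 h.eig_inv.swap i y z
  simp only [schurInv_apply, Matrix.transpose_apply, Matrix.smul_apply, smul_eq_mul, mul_assoc,
    ← Finset.mul_sum] at h1
  simp only [mul_assoc]
  exact mul_left_cancel₀ card_cast_ne_zero h1

theorem eig_schurInv (h : IsSymmPair A B) :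
    IsEigMatrix (schurInv A) (schurInv B) (schurInv A)
      ((Fintype.card ι : ℂ) • schurInv B) := by
  have h1 := h.left.isEigMatrix_transpose_schurInv h.right.ne_zero h.eig_inv
  rwa [← schurInv_transpose, h.symm] at h1

/-- Solve for `R`, then average against a row of `B`: by `sum_right` the sum of `B`-quotients
collapses to a quotient of entries of `A`. With `eig_schurInv_hadamard` this gives `A ∘ N_{A,B} =
N_A`. -/
theorem eig_hadamard (h : IsSymmPair A B) (hR : IsEigMatrix A B R ρ) :
    IsEigMatrix A (schurInv A) (A ⊙ R) ((Fintype.card ι : ℂ)⁻¹ • (ρ * Bᵀ)) := by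
  have h1 := (h.left.isEigMatrix_iff_left h.right.ne_zero).1 hR
  rw [h.left.isEigMatrix_iff_left h.left.inv.ne_zero]
  intro j y z
  have hc := card_cast_ne_zero (ι := ι)
  have h2 : ∀ i, ((Fintype.card ι : ℂ)⁻¹ • (ρ * Bᵀ)) i j * A y i * (A z i)⁻¹ =
      ∑ k, (Fintype.card ι : ℂ)⁻¹ * B j k * (ρ i k * A y i * (A z i)⁻¹) := by
    intro i
    simp only [Matrix.smul_apply, Matrix.mul_apply, Matrix.transpose_apply, smul_eq_mul,
      Finset.mul_sum, Finset.sum_mul]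
    exact Finset.sum_congr rfl fun k _ => by ring
  simp only [h2]
  rw [Finset.sum_comm]
  simp only [← Finset.mul_sum, h1]
  have h3 : ∀ k, (Fintype.card ι : ℂ)⁻¹ * B j k * (Fintype.card ι * (R y z * B z k * (B y k)⁻¹))
      = R y z * (B j k * B z k * (B y k)⁻¹) := by
    intro k
    field_simp
  simp only [h3, ← Finset.mul_sum, h.sum_right, Matrix.hadamard_apply, schurInv_apply, inv_inv]
  rw [h.symm.apply y z]
  ring

theorem eig_schurInv_hadamard (h : IsSymmPair A B) (hK : IsEigMatrix A (schurInv A) K θ) :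
    IsEigMatrix A B (schurInv A ⊙ K) (θ * schurInv B) := by
  have h1 := (h.left.isEigMatrix_iff_left h.left.inv.ne_zero).1 hK
  rw [h.left.isEigMatrix_iff_left h.right.ne_zero]
  intro j y z
  have h2 : ∀ i, (θ * schurInv B) i j * A y i * (A z i)⁻¹ =
      ∑ k, (B k j)⁻¹ * (θ i k * A y i * (A z i)⁻¹) := by
    intro i
    simp only [Matrix.mul_apply, schurInv_apply, Finset.sum_mul]
    exact Finset.sum_congr rfl fun k _ => by ring
  simp only [h2]
  rw [Finset.sum_comm]
  simp only [← Finset.mul_sum, h1]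
  have h3 : ∀ k, (B k j)⁻¹ *
      (Fintype.card ι * (K y z * schurInv A z k * (schurInv A y k)⁻¹))
      = Fintype.card ι * K y z * ((B k j)⁻¹ * A y k * (A z k)⁻¹) := by
    intro k
    rw [schurInv_apply, schurInv_apply, inv_inv]
    ring
  rw [Finset.sum_congr rfl fun k _ => h3 k, ← Finset.mul_sum, h.sum_left_inv,
    Matrix.hadamard_apply, schurInv_apply]
  ring

/-- The analogue for the lower diagonal block, with `N_{Bᵀ}` in place of `N_A`. -/
theorem eig_hadamard_companion (h : IsSymmPair A B)
    (hR : IsEigMatrix (schurInv A) (schurInv Bᵀ) R₁ ρ) :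
    IsEigMatrix Bᵀ (schurInv Bᵀ) (A ⊙ R₁) ((Fintype.card ι : ℂ)⁻¹ • (B * ρ)) := by
  have h1 := h.left.inv.isEigMatrix_iff.1 hR
  intro i j y
  apply mul_left_cancel₀ (card_cast_ne_zero (ι := ι))
  have h2 : ∀ z, (Fintype.card ι : ℂ) * ((A ⊙ R₁) y z * (Bᵀ z i * schurInv Bᵀ z j)) =
      ∑ k, ρ k j * (schurInv A y k * schurInv Bᵀ y j) * (A y z * (A z k * Bᵀ z i)) := by
    intro z
    have := h1 j y z
    simp only [schurInv_apply, inv_inv] at this ⊢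
    calc _ = Fintype.card ι * (R₁ y z * (Bᵀ z j)⁻¹) * (A y z * Bᵀ z i) := by
          rw [Matrix.hadamard_apply]; ring
      _ = _ := by
          rw [← this, Finset.sum_mul]
          exact Finset.sum_congr rfl fun k _ => by ring
  rw [Finset.mul_sum, Finset.sum_congr rfl fun z _ => h2 z, Finset.sum_comm]
  simp only [← Finset.mul_sum, h.eig_transpose _ i y]
  simp only [Matrix.smul_apply, smul_eq_mul, Matrix.mul_apply, Matrix.transpose_apply,
    schurInv_apply, ← mul_assoc]
  rw [mul_inv_cancel₀ card_cast_ne_zero, one_mul, Finset.sum_mul, Finset.sum_mul]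
  refine Finset.sum_congr rfl fun k _ => ?_
  have := h.left.ne_zero y k
  field_simp

theorem eig_schurInv_hadamard_companion (h : IsSymmPair A B)
    (hK : IsEigMatrix Bᵀ (schurInv Bᵀ) K θ) :
    IsEigMatrix (schurInv A) (schurInv Bᵀ) (schurInv A ⊙ K) (schurInv Bᵀ * θ) := by
  have h1 := h.right.transpose.isEigMatrix_iff.1 hK
  intro i j y
  apply mul_left_cancel₀ (card_cast_ne_zero (ι := ι))
  have h2 : ∀ z, (Fintype.card ι : ℂ) *
      ((schurInv A ⊙ K) y z * (schurInv A z i * schurInv Bᵀ z j)) =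
      ∑ k, θ k j * (Bᵀ y k * schurInv Bᵀ y j) *
        (schurInv A y z * (schurInv A z i * schurInv Bᵀ z k)) := by
    intro z
    have := h1 j y z
    calc _ = Fintype.card ι * (K y z * schurInv Bᵀ z j) * (schurInv A y z * schurInv A z i) := by
          rw [Matrix.hadamard_apply]; ring
      _ = _ := by
          rw [← this, Finset.sum_mul]
          exact Finset.sum_congr rfl fun k _ => by rw [schurInv_apply Bᵀ z k]; ring
  rw [Finset.mul_sum, Finset.sum_congr rfl fun z _ => h2 z, Finset.sum_comm]
  simp only [← Finset.mul_sum, h.transpose.eig_schurInv i _ y]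
  simp only [Matrix.smul_apply, smul_eq_mul, Matrix.mul_apply, Finset.sum_mul, Finset.mul_sum]
  refine Finset.sum_congr rfl fun k _ => ?_
  have := h.right.transpose.ne_zero y k
  simp only [schurInv_apply, Matrix.transpose_apply] at this ⊢
  field_simp

theorem isUnit_det (h : IsSymmPair A B) : IsUnit B.det := by
  refine Matrix.isUnit_det_of_right_inverse
    (B := (Fintype.card ι : ℂ)⁻¹ • (schurInv B)ᵀ) ?_
  rw [Matrix.mul_smul, h.right.mul_eq, smul_smul, inv_mul_cancel₀ card_cast_ne_zero, one_smul]

theorem inv_eq (h : IsSymmPair A B) : B⁻¹ = (Fintype.card ι : ℂ)⁻¹ • (schurInv B)ᵀ := by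
  refine Matrix.inv_eq_right_inv ?_
  rw [Matrix.mul_smul, h.right.mul_eq, smul_smul, inv_mul_cancel₀ card_cast_ne_zero, one_smul]

/-- `B⁻¹` is `n⁻¹ B⁽⁻⁾ᵀ`, and by `sum_left_inv` it sends the eigenvectors of `N_A` to multiples of
those of `N_{Bᵀ}`, with the two indices exchanged. -/
theorem eig_conj (h : IsSymmPair A B) (hF : IsEigMatrix A (schurInv A) F θ) :
    IsEigMatrix Bᵀ (schurInv Bᵀ) (B⁻¹ * F * B) θᵀ := by
  refine hF.transport (X := B⁻¹) (c := fun x z => (Fintype.card ι : ℂ)⁻¹ * (A x z)⁻¹)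
    (fun x z => mul_ne_zero (inv_ne_zero card_cast_ne_zero) (inv_ne_zero (h.left.ne_zero x z)))
    ?_ (by rw [Matrix.mul_assoc _ B, Matrix.mul_nonsing_inv _ h.isUnit_det, Matrix.mul_one])
  intro x z j
  have h1 := h.sum_left_inv j x z
  rw [h.inv_eq]
  simp only [Matrix.smul_apply, Matrix.transpose_apply, schurInv_apply, smul_eq_mul]
  rw [mul_assoc, ← mul_assoc (A x z)⁻¹, ← h1, Finset.mul_sum]
  exact Finset.sum_congr rfl fun y _ => by rw [h.symm.apply x y, h.symm.apply z y]; ring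

theorem eig_conj_symm (h : IsSymmPair A B) (hG : IsEigMatrix A (schurInv A) G θ)
    (hF : F * B = B * G) : IsEigMatrix B (schurInv B) F θᵀ := by
  refine hG.transport (X := B) (c := fun x z => (Fintype.card ι : ℂ) * A x z)
    (fun x z => mul_ne_zero card_cast_ne_zero (h.left.ne_zero x z)) ?_ hF
  intro x z j
  have h1 := h.transpose.sum_left j x z
  simp only [Matrix.transpose_apply] at h1
  rw [mul_assoc, ← mul_assoc (A x z), ← h1]
  exact Finset.sum_congr rfl fun y _ => by rw [h.symm.apply x y, h.symm.apply z y]; ring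

/-- `N_{Bᵀ} ⊆ N_A`. -/
theorem exists_eig_of_eig_transpose (h : IsSymmPair A B)
    (hK : IsEigMatrix Bᵀ (schurInv Bᵀ) K θ) : ∃ S, IsEigMatrix A (schurInv A) K S := by
  -- Divide `K` entrywise by `A`, transpose into `N_{A,Bᵀ}`, and multiply by `A` again to land in
  -- `N_A`; as `A` is symmetric this yields `Kᵀ`.
  have h1 := h.left.inv.isEigMatrix_transpose_schurInv h.right.transpose.inv.ne_zero
    (h.eig_schurInv_hadamard_companion hK)
  rw [schurInv_schurInv, schurInv_schurInv] at h1
  have h2 := h.left.isEigMatrix_transpose (h.transpose.eig_hadamard h1)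
  have h3 : (A ⊙ (schurInv A ⊙ K)ᵀ)ᵀ = K := by
    ext i j
    have := h.left.ne_zero i j
    simp only [Matrix.transpose_apply, Matrix.hadamard_apply, schurInv_apply, h.symm.apply i j]
    field_simp
  rw [h3] at h2
  exact ⟨_, h2⟩

/-- Needed for its dual: `A⁽⁻⁾ ∘ A⁽⁻⁾` lies in `N_A`, with eigenvalue matrix `n B⁽⁻⁾ B⁽⁻⁾ᵀ`. -/
theorem eig_mul_transpose (h : IsSymmPair A B) :
    IsEigMatrix A (schurInv A) (schurInv B * (schurInv B)ᵀ) (schurInv A ⊙ schurInv A) := by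
  intro i j y
  have h1 : ∀ z, (schurInv B * (schurInv B)ᵀ) y z * (A z i * schurInv A z j) =
      ∑ k, (B y k)⁻¹ * ((B z k)⁻¹ * A i z * (A j z)⁻¹) := by
    intro z
    simp only [Matrix.mul_apply, schurInv_apply, Matrix.transpose_apply, Finset.sum_mul]
    exact Finset.sum_congr rfl fun k _ => by rw [h.symm.apply i z, h.symm.apply j z]; ring
  rw [Finset.sum_congr rfl fun z _ => h1 z, Finset.sum_comm]
  simp only [← Finset.mul_sum, h.sum_left_inv]
  have h2 := h.sum_right_inv y j i
  have h3 : ∀ k, (B y k)⁻¹ * ((A i j)⁻¹ * B j k * (B i k)⁻¹) =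
      (A i j)⁻¹ * ((B y k)⁻¹ * B j k * (B i k)⁻¹) := fun k => by ring
  simp only [h3, ← Finset.mul_sum, h2, Matrix.hadamard_apply, schurInv_apply]
  rw [h.symm.apply i j, h.symm.apply y i, h.symm.apply y j]
  ring

theorem eig_mul_transpose_right (h : IsSymmPair A B) :
    IsEigMatrix Bᵀ (schurInv Bᵀ) ((schurInv B)ᵀ * schurInv B) (schurInv A ⊙ schurInv A) := by
  intro i j y
  have h1 : ∀ z, ((schurInv B)ᵀ * schurInv B) y z * (Bᵀ z i * schurInv Bᵀ z j) =
      ∑ k, (B k y)⁻¹ * ((B k z)⁻¹ * B i z * (B j z)⁻¹) := by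
    intro z
    simp only [Matrix.mul_apply, schurInv_apply, Matrix.transpose_apply, Finset.sum_mul]
    exact Finset.sum_congr rfl fun k _ => by ring
  rw [Finset.sum_congr rfl fun z _ => h1 z, Finset.sum_comm]
  simp only [← Finset.mul_sum, h.sum_right_inv]
  have h2 := h.sum_left_inv y j i
  have h3 : ∀ k, (B k y)⁻¹ * ((A i j)⁻¹ * A j k * (A i k)⁻¹) =
      (A i j)⁻¹ * ((B k y)⁻¹ * A j k * (A i k)⁻¹) := fun k => by ring
  simp only [h3, ← Finset.mul_sum, h2, Matrix.hadamard_apply, schurInv_apply]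
  rw [h.symm.apply i j]
  simp only [Matrix.transpose_apply]
  ring

end IsSymmPair

end JonesPair

/-! ### Invertible Jones pairs are type II. -/

namespace JonesPair

open Matrix

theorem ne_zero_of_isUnit_opDelta {ι : Type*} {B : Matrix ι ι ℂ} (h : IsUnit (opDelta B)) (i j : ι) :
    B i j ≠ 0 := by
  obtain ⟨C, hC⟩ := ((Module.End.isUnit_iff _).1 h).2 (allOnes ι)
  have h1 : B i j * C i j = 1 := congrFun (congrFun hC i) j
  exact left_ne_zero_of_mul_eq_one h1

variable {ι : Type*} [Fintype ι] [DecidableEq ι]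

theorem exists_inverse_of_isUnit_opX {A : Matrix ι ι ℂ} (h : IsUnit (opX A)) :
    ∃ C, A * C = 1 ∧ C * A = 1 := by
  obtain ⟨C, hC⟩ := ((Module.End.isUnit_iff _).1 h).2 1
  have hC' : A * C = 1 := hC
  exact ⟨C, hC', mul_eq_one_comm.1 hC'⟩

/-- Evaluate the braid relation at the matrix unit `E_ij` and read off column `j`. -/
theorem IsOneSidedJonesPair.isEigMatrix {A B : Matrix ι ι ℂ} (h : IsOneSidedJonesPair A B) :
    IsEigMatrix A B A B := by
  intro i j x
  have h1 := congrFun (congrFun (LinearMap.congr_fun h.braid (Matrix.single i j 1)) x) j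
  have h2 : (A * (B ⊙ (A * Matrix.single i j (1 : ℂ)))) x j =
    (B ⊙ (A * (B ⊙ Matrix.single i j (1 : ℂ)))) x j := h1
  simp only [Matrix.mul_apply, Matrix.hadamard_apply, Matrix.single_apply] at h2
  simp only [and_true, mul_ite, mul_one, mul_zero, Finset.sum_ite_eq, Finset.mem_univ,
    if_true] at h2
  simp only [mul_comm (A _ i), h2]
  ring

/-- The two matrices of an invertible Jones pair are type II. -/
theorem IsInvertibleJonesPair.isTypeII {A B : Matrix ι ι ℂ} [Nonempty ι]
    (h : IsInvertibleJonesPair A B) : IsTypeII A ∧ IsTypeII B := by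
  obtain ⟨C, hAC, hCA⟩ := exists_inverse_of_isUnit_opX h.isJonesPair.1.isUnit_opX
  have hB := ne_zero_of_isUnit_opDelta h.isJonesPair.1.isUnit_opDelta
  have hc := card_cast_ne_zero (ι := ι)
  -- The eigenvector equations solved with `C = A⁻¹`; applied below to both `B` and `Bᵀ`.
  have key : ∀ {D : Matrix ι ι ℂ}, IsEigMatrix A D A D → ∀ j x z,
      A x z * D z j = ∑ i, D i j * (A x i * D x j) * C i z := by
    intro D hD j x z
    simp only [← hD _ j x, Finset.sum_mul]
    rw [Finset.sum_comm]
    have h1 : ∀ y, ∑ i, A x y * (A y i * D y j) * C i z =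
        A x y * D y j * (1 : Matrix ι ι ℂ) y z := by
      intro y
      rw [← hAC, Matrix.mul_apply, Finset.mul_sum]
      exact Finset.sum_congr rfl fun i _ => by ring
    simp [h1, Matrix.one_apply]
  have hE := h.isJonesPair.1.isEigMatrix
  have hE' := h.isJonesPair.2.isEigMatrix
  have diag : ∀ {D : Matrix ι ι ℂ}, IsEigMatrix A D A D → (∀ i j, D i j ≠ 0) → ∀ j x,
      ∑ i, A x i * C i x * D i j = A x x := by
    intro D hD hD0 j x
    apply mul_right_cancel₀ (hD0 x j)
    rw [key hD j x x, Finset.sum_mul]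
    exact Finset.sum_congr rfl fun i _ => by ring
  -- The aim is `W = n⁻¹ J`, that is, `C = n⁻¹ A⁽⁻⁾ᵀ`. The rows of `W B` are constant, so
  -- invertibility of `B` forces `W x i = A x x * u i`; `A C = 1` and `C A = 1` make all row and
  -- column sums of `W` equal to 1.
  set W : Matrix ι ι ℂ := Matrix.of fun x i => A x i * C i x with hW
  have hWB : W * B = Matrix.of fun x _ => A x x := by
    ext x j
    exact diag hE hB j x
  obtain ⟨B', hB'⟩ := h.isUnit.exists_right_inv
  have hWu : ∀ x i, W x i = A x x * ∑ j, B' j i := by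
    intro x i
    have h1 : W = (Matrix.of fun x _ => A x x) * B' := by
      rw [← hWB, Matrix.mul_assoc, hB', Matrix.mul_one]
    rw [h1, Matrix.mul_apply, Finset.mul_sum]
    rfl
  set u : ι → ℂ := fun i => ∑ j, B' j i with hu
  have hrow : ∀ x, A x x * ∑ i, u i = 1 := by
    intro x
    have h1 : ∑ i, W x i = 1 := by
      have := congrFun (congrFun hAC x) x
      rwa [Matrix.mul_apply, Matrix.one_apply_eq] at this
    rw [← h1, Finset.mul_sum]
    exact Finset.sum_congr rfl fun i _ => (hWu x i).symm
  have hcol : ∀ i, (∑ x, A x x) * u i = 1 := by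
    intro i
    have h1 : ∑ x, W x i = 1 := by
      have := congrFun (congrFun hCA i) i
      rw [Matrix.mul_apply, Matrix.one_apply_eq] at this
      rw [← this]
      exact Finset.sum_congr rfl fun x _ => mul_comm _ _
    rw [← h1, Finset.sum_mul]
    exact Finset.sum_congr rfl fun x _ => (hWu x i).symm
  obtain ⟨a, ha⟩ : ∃ a, ∀ x, A x x = a :=
    ⟨(∑ i, u i)⁻¹, fun x => eq_inv_of_mul_eq_one_left (hrow x)⟩
  have hW' : ∀ x i, W x i = (Fintype.card ι : ℂ)⁻¹ := by
    intro x i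
    apply eq_inv_of_mul_eq_one_right
    rw [hWu, ← hcol i]
    simp [ha, mul_assoc, hu]
  have hA0 : ∀ x i, A x i ≠ 0 := h.schurInvertible
  have hC : ∀ i x, C i x = (Fintype.card ι : ℂ)⁻¹ * (A x i)⁻¹ := by
    intro i x
    rw [← hW' x i, hW, Matrix.of_apply]
    have := hA0 x i
    field_simp
  have hAII : IsTypeII A := by
    refine ⟨hA0, ?_⟩
    have h1 : (schurInv A)ᵀ = (Fintype.card ι : ℂ) • C := by
      ext i x
      rw [Matrix.smul_apply, hC, smul_eq_mul, mul_inv_cancel_left₀ hc]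
      rfl
    rw [h1, Matrix.mul_smul, hAC]
  refine ⟨hAII, hB, ?_⟩
  -- The relation for `Bᵀ` says that all row sums of `B` agree; this is where the second one-sided
  -- pair enters.
  have hrowB : ∀ j, ∑ i, B j i = Fintype.card ι * a := by
    intro j
    have h1 := diag hE' (fun i j => hB j i) j j
    have h2 : ∀ i, A j i * C i j * Bᵀ i j = (Fintype.card ι : ℂ)⁻¹ * B j i := by
      intro i
      rw [← hW' j i]
      rfl
    simp only [h2, ← Finset.mul_sum, ha] at h1
    rw [← h1, mul_inv_cancel_left₀ hc]
  ext x z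
  rw [Matrix.mul_apply, Matrix.smul_apply, Matrix.one_apply]
  simp only [Matrix.transpose_apply, schurInv_apply]
  split_ifs with hxz
  · subst hxz
    simp [mul_inv_cancel₀ (hB x _)]
  -- Expanding by `key` and summing over `j` first leaves the constant row sum of `B` times the
  -- inner product of row `z` of `A` with row `x` of `A⁽⁻⁾`, which vanishes.
  · have h1 : A z x * ∑ j, B x j * (B z j)⁻¹ = 0 := by
      have h2 : ∀ j, A z x * (B x j * (B z j)⁻¹) =
          ∑ i, B i j * (A z i * (A x i)⁻¹ * (Fintype.card ι : ℂ)⁻¹) := by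
        intro j
        rw [← mul_assoc, key hE j z x, Finset.sum_mul]
        refine Finset.sum_congr rfl fun i _ => ?_
        rw [hC]
        have := hB z j
        field_simp
      rw [Finset.mul_sum, Finset.sum_congr rfl fun j _ => h2 j, Finset.sum_comm]
      simp only [← Finset.sum_mul, hrowB]
      rw [← Finset.mul_sum, ← Finset.sum_mul, hAII.sum_row, if_neg (Ne.symm hxz)]
      simp
    simpa using (mul_eq_zero.1 h1).resolve_left (hA0 z x)

theorem IsInvertibleJonesPair.isSymmPair {A B : Matrix ι ι ℂ} [Nonempty ι]
    (h : IsInvertibleJonesPair A B) (hA : A.IsSymm) : IsSymmPair A B where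
  symm := hA
  left := h.isTypeII.1
  right := h.isTypeII.2
  eig := h.isJonesPair.1.isEigMatrix
  eig_transpose := h.isJonesPair.2.isEigMatrix

end JonesPair

/-! ### A criterion for Bose–Mesner algebras. -/

namespace JonesPair

open Matrix

variable {κ : Type*} [Fintype κ] [DecidableEq κ]

/-- A space of matrices containing `I` and `J`, closed under both products and transposition, and
commutative, is a Bose–Mesner algebra. -/
theorem isBoseMesnerAlgebra_of_closed [Nonempty κ] (𝓑 : Submodule ℂ (Matrix κ κ ℂ))
    (h_one : 1 ∈ 𝓑) (h_ones : allOnes κ ∈ 𝓑)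
    (h_had : ∀ M ∈ 𝓑, ∀ N ∈ 𝓑, M ⊙ N ∈ 𝓑) (h_mul : ∀ M ∈ 𝓑, ∀ N ∈ 𝓑, M * N ∈ 𝓑)
    (h_tr : ∀ M ∈ 𝓑, Mᵀ ∈ 𝓑) (h_comm : ∀ M ∈ 𝓑, ∀ N ∈ 𝓑, M * N = N * M) :
    IsBoseMesnerAlgebra 𝓑 := by
  classical
  -- The relations of the scheme: two positions are equivalent when no matrix in `𝓑` separates them.
  let s : Setoid (κ × κ) :=
    { r := fun p q => ∀ M ∈ 𝓑, M p.1 p.2 = M q.1 q.2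
      iseqv := ⟨fun _ _ _ => rfl, fun h M hM => (h M hM).symm,
        fun h h' M hM => (h M hM).trans (h' M hM)⟩ }
  have hs : ∀ p q : κ × κ, (Quotient.mk s p = Quotient.mk s q) ↔
      ∀ M ∈ 𝓑, M p.1 p.2 = M q.1 q.2 := fun p q => Quotient.eq
  let ind : Quotient s → Matrix κ κ ℂ := fun c => Matrix.of fun x y =>
    if Quotient.mk s (x, y) = c then 1 else 0
  have hprod : ∀ (t : Finset (κ × κ)) (f : κ × κ → Matrix κ κ ℂ), (∀ q ∈ t, f q ∈ 𝓑) →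
      (Matrix.of fun x y => ∏ q ∈ t, f q x y) ∈ 𝓑 := by
    intro t f
    induction t using Finset.induction_on with
    | empty => intro _; simpa [allOnes] using h_ones
    | insert a t ha ih =>
      intro hf
      have h1 := h_had _ (hf a (Finset.mem_insert_self a t)) _
        (ih fun q hq => hf q (Finset.mem_insert_of_mem hq))
      convert h1 using 1
      ext x y
      simp [Finset.prod_insert ha]
  have hind : ∀ c, ind c ∈ 𝓑 := by
    intro c
    obtain ⟨p, rfl⟩ := Quotient.exists_rep c
    -- Lagrange interpolation: the entrywise product of these factors over all `q` is the indicator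
    -- of the class of `p`.
    have hsep : ∀ q : κ × κ, ∃ f ∈ 𝓑, f p.1 p.2 = 1 ∧
        (Quotient.mk s q ≠ Quotient.mk s p → f q.1 q.2 = 0) := by
      intro q
      by_cases hq : Quotient.mk s q = Quotient.mk s p
      · exact ⟨_, h_ones, rfl, fun h => absurd hq h⟩
      · rw [hs] at hq
        push Not at hq
        obtain ⟨M, hM, hne⟩ := hq
        refine ⟨(M p.1 p.2 - M q.1 q.2)⁻¹ • (M - M q.1 q.2 • allOnes κ),
          𝓑.smul_mem _ (𝓑.sub_mem hM (𝓑.smul_mem _ h_ones)), ?_, fun _ => ?_⟩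
        · simp [allOnes, inv_mul_cancel₀ (sub_ne_zero.2 hne.symm)]
        · simp [allOnes]
    choose f hf hf1 hf0 using hsep
    have h1 := hprod Finset.univ f fun q _ => hf q
    convert h1 using 1
    ext x y
    simp only [ind, Matrix.of_apply]
    split_ifs with hxy
    · symm
      refine Finset.prod_eq_one fun q _ => ?_
      rw [(hs _ _).1 hxy (f q) (hf q)]
      exact hf1 q
    · symm
      exact Finset.prod_eq_zero (Finset.mem_univ (x, y)) (hf0 (x, y) hxy)
  have hspan : ∀ M ∈ 𝓑, M ∈ Submodule.span ℂ (Set.range ind) := by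
    intro M hM
    have h1 : M = ∑ c, M c.out.1 c.out.2 • ind c := by
      ext x y
      simp only [Matrix.sum_apply, Matrix.smul_apply, ind, Matrix.of_apply, smul_eq_mul, mul_ite,
        mul_one, mul_zero, Finset.sum_ite_eq, Finset.mem_univ, if_true]
      exact ((hs _ _).1 (Quotient.out_eq (Quotient.mk s (x, y))) M hM).symm
    rw [h1]
    exact Submodule.sum_mem _ fun c _ =>
      Submodule.smul_mem _ _ (Submodule.subset_span ⟨c, rfl⟩)
  -- `M ∘ I` commutes with `J`, which makes the diagonal of `M` constant; hence the diagonal is a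
  -- single class.
  have hdiag : ∀ M ∈ 𝓑, ∀ x y, M x x = M y y := by
    intro M hM x y
    have h1 := congrFun (congrFun (h_comm _ (h_had M hM 1 h_one) _ h_ones) x) y
    simpa [Matrix.mul_apply, allOnes, Matrix.one_apply] using h1
  let x₀ : κ := Classical.arbitrary κ
  let c₀ : Quotient s := Quotient.mk s (x₀, x₀)
  have hind0 : ind c₀ = 1 := by
    ext x y
    simp only [ind, c₀, Matrix.of_apply, Matrix.one_apply]
    refine if_congr ⟨fun h => ?_, fun h => ?_⟩ rfl rfl
    · by_contra hxy
      have := (hs _ _).1 h 1 h_one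
      simp [hxy] at this
    · subst h
      exact (hs _ _).2 fun M hM => hdiag M hM x x₀
  obtain ⟨m, hm⟩ : ∃ m, Fintype.card (Quotient s) = m + 1 :=
    ⟨_, (Nat.succ_pred_eq_of_pos (Fintype.card_pos_iff.2 ⟨c₀⟩)).symm⟩
  let e₁ : Quotient s ≃ Fin (m + 1) := Fintype.equivFinOfCardEq hm
  -- The swap moves the diagonal class to index 0.
  let e : Fin (m + 1) ≃ Quotient s := (e₁.trans (Equiv.swap (e₁ c₀) 0)).symm
  have he : e 0 = c₀ := by simp [e]
  have hrange : Set.range (fun k => ind (e k)) = Set.range ind := e.surjective.range_comp ind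
  have hB : 𝓑 = Submodule.span ℂ (Set.range fun k => ind (e k)) := by
    rw [hrange]
    refine le_antisymm hspan (Submodule.span_le.2 ?_)
    rintro _ ⟨c, rfl⟩
    exact hind c
  refine ⟨m, fun k => ind (e k), ⟨?_, ?_, ?_, ?_, ?_, ?_, ?_⟩, hB⟩
  · intro k x y
    simp only [ind, Matrix.of_apply]
    split_ifs
    · exact Or.inr rfl
    · exact Or.inl rfl
  · intro k h0
    obtain ⟨p, hp⟩ := Quotient.exists_rep (e k)
    have h1 := congrFun (congrFun h0 p.1) p.2
    simp [ind, hp] at h1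
  · simp only [he, hind0]
  · ext x y
    rw [Equiv.sum_comp e ind, Matrix.sum_apply]
    simp [ind, allOnes]
  · intro k
    obtain ⟨p, hp⟩ := Quotient.exists_rep (e k)
    refine ⟨e.symm (Quotient.mk s (p.2, p.1)), ?_⟩
    ext x y
    simp only [ind, Matrix.transpose_apply, Matrix.of_apply, Equiv.apply_symm_apply, ← hp]
    refine if_congr ?_ rfl rfl
    rw [hs, hs]
    exact ⟨fun h M hM => h _ (h_tr M hM), fun h M hM => h _ (h_tr M hM)⟩
  · intro k l
    rw [← hB]
    exact h_mul _ (hind _) _ (hind _)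
  · intro k l
    exact h_comm _ (hind _) _ (hind _)

end JonesPair

/-! ### Even and odd pairs: closure properties and the description of `Ŝ`. -/

namespace JonesPair

open Matrix

variable {ι : Type*} [Fintype ι]

/-- `F ∈ N_A` and `G ∈ N_{Bᵀ}` have transposed matrices of eigenvalues. -/
def EvenPair (A B F G : Matrix ι ι ℂ) : Prop :=
  ∃ θ, IsEigMatrix A (schurInv A) F θ ∧ IsEigMatrix Bᵀ (schurInv Bᵀ) G θᵀ

/-- `R ∈ N_{A,B}` and `R₁ ∈ N_{A⁽⁻⁾,B⁽⁻⁾ᵀ}` have transposed matrices of eigenvalues. -/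
def OddPair (A B R R₁ : Matrix ι ι ℂ) : Prop :=
  ∃ ρ, IsEigMatrix A B R ρ ∧ IsEigMatrix (schurInv A) (schurInv Bᵀ) R₁ ρᵀ

variable {A B F G F' G' K K₁ R R₁ R' R₁' : Matrix ι ι ℂ}

theorem EvenPair.add (h : EvenPair A B F G) (h' : EvenPair A B F' G') :
    EvenPair A B (F + F') (G + G') := by
  obtain ⟨θ, h1, h2⟩ := h
  obtain ⟨θ', h1', h2'⟩ := h'
  exact ⟨θ + θ', h1.add h1', by rw [Matrix.transpose_add]; exact h2.add h2'⟩

theorem EvenPair.smul (c : ℂ) (h : EvenPair A B F G) : EvenPair A B (c • F) (c • G) := by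
  obtain ⟨θ, h1, h2⟩ := h
  exact ⟨c • θ, h1.smul c, by rw [Matrix.transpose_smul]; exact h2.smul c⟩

theorem EvenPair.mul (h : EvenPair A B F G) (h' : EvenPair A B F' G') :
    EvenPair A B (F * F') (G * G') := by
  obtain ⟨θ, h1, h2⟩ := h
  obtain ⟨θ', h1', h2'⟩ := h'
  exact ⟨θ ⊙ θ', h1.mul h1', h2.mul h2'⟩

theorem OddPair.add (h : OddPair A B R R₁) (h' : OddPair A B R' R₁') :
    OddPair A B (R + R') (R₁ + R₁') := by
  obtain ⟨θ, h1, h2⟩ := h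
  obtain ⟨θ', h1', h2'⟩ := h'
  exact ⟨θ + θ', h1.add h1', by rw [Matrix.transpose_add]; exact h2.add h2'⟩

theorem OddPair.smul (c : ℂ) (h : OddPair A B R R₁) : OddPair A B (c • R) (c • R₁) := by
  obtain ⟨θ, h1, h2⟩ := h
  exact ⟨c • θ, h1.smul c, by rw [Matrix.transpose_smul]; exact h2.smul c⟩

theorem OddPair.mul (h : OddPair A B R R₁) (h' : OddPair A B R' R₁') :
    OddPair A B (R * R') (R₁ * R₁') := by
  obtain ⟨θ, h1, h2⟩ := h
  obtain ⟨θ', h1', h2'⟩ := h'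
  exact ⟨θ ⊙ θ', h1.mul h1', h2.mul h2'⟩

theorem OddPair.zero : OddPair A B 0 0 :=
  ⟨0, isEigMatrix_zero _ _, by rw [Matrix.transpose_zero]; exact isEigMatrix_zero _ _⟩

variable [DecidableEq ι]

theorem EvenPair.one : EvenPair A B 1 1 :=
  ⟨allOnes ι, isEigMatrix_one _ _, isEigMatrix_one _ _⟩

theorem OddPair.one : OddPair A B 1 1 :=
  ⟨allOnes ι, isEigMatrix_one _ _, isEigMatrix_one _ _⟩

namespace IsSymmPair

theorem schurInv_hadamard_cancel (h : IsSymmPair A B) (M : Matrix ι ι ℂ) :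
    schurInv A ⊙ (A ⊙ M) = M := by
  ext i j
  exact inv_mul_cancel_left₀ (h.left.ne_zero i j) _

theorem hadamard_schurInv_cancel (h : IsSymmPair A B) (M : Matrix ι ι ℂ) :
    A ⊙ (schurInv A ⊙ M) = M := by
  ext i j
  exact mul_inv_cancel_left₀ (h.left.ne_zero i j) _

variable [Nonempty ι]

theorem evenPair_allOnes (h : IsSymmPair A B) : EvenPair A B (allOnes ι) (allOnes ι) :=
  ⟨_, h.left.isEigMatrix_allOnes, by
    rw [Matrix.transpose_smul, Matrix.transpose_one]
    exact h.right.transpose.isEigMatrix_allOnes⟩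

theorem evenPair_transpose (h : IsSymmPair A B) (hF : EvenPair A B F G) :
    EvenPair A B Fᵀ Gᵀ := by
  obtain ⟨θ, h1, h2⟩ := hF
  exact ⟨θᵀ, h.left.isEigMatrix_transpose h1, h.right.transpose.isEigMatrix_transpose h2⟩

theorem evenPair_hadamard (h : IsSymmPair A B) (hF : EvenPair A B F G)
    (hF' : EvenPair A B F' G') : EvenPair A B (F ⊙ F') (G ⊙ G') := by
  obtain ⟨θ, h1, h2⟩ := hF
  obtain ⟨θ', h1', h2'⟩ := hF'
  refine ⟨_, h.left.isEigMatrix_hadamard h1 h1', ?_⟩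
  -- Transposition reverses the product of eigenvalue matrices, so the factors on the `G` side are
  -- exchanged.
  rw [Matrix.transpose_smul, Matrix.transpose_mul, Matrix.hadamard_comm]
  exact h.right.transpose.isEigMatrix_hadamard h2' h2

/-- The eigenvalues determine `G`, and `B⁻¹ * F * B` has the required ones. -/
theorem evenPair_iff (h : IsSymmPair A B) :
    EvenPair A B F G ↔ F ∈ nomura A ∧ G = B⁻¹ * F * B := by
  constructor
  · rintro ⟨θ, h1, h2⟩
    exact ⟨mem_nomuraPair_iff.2 ⟨θ, h1⟩, h.right.transpose.eq_of_isEigMatrix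
      h.right.transpose.inv.ne_zero h2 (h.eig_conj h1)⟩
  · rintro ⟨h1, rfl⟩
    obtain ⟨θ, h1⟩ := mem_nomuraPair_iff.1 h1
    exact ⟨θ, h1, h.eig_conj h1⟩

theorem oddPair_of_evenPair (h : IsSymmPair A B) (hK : EvenPair A B K K₁) :
    OddPair A B (schurInv A ⊙ K) (schurInv A ⊙ K₁) := by
  obtain ⟨θ, h1, h2⟩ := hK
  refine ⟨_, h.eig_schurInv_hadamard h1, ?_⟩
  rw [Matrix.transpose_mul, ← schurInv_transpose]
  exact h.eig_schurInv_hadamard_companion h2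

/-- Reduces closure of odd pairs under transposition and entrywise products to the even case. -/
theorem oddPair_iff (h : IsSymmPair A B) :
    OddPair A B R R₁ ↔ EvenPair A B (A ⊙ R) (A ⊙ R₁) := by
  constructor
  · rintro ⟨ρ, h1, h2⟩
    refine ⟨_, h.eig_hadamard h1, ?_⟩
    rw [Matrix.transpose_smul, Matrix.transpose_mul, Matrix.transpose_transpose]
    exact h.eig_hadamard_companion h2
  · intro h1
    have h2 := h.oddPair_of_evenPair h1
    rwa [h.schurInv_hadamard_cancel, h.schurInv_hadamard_cancel] at h2

theorem oddPair_transpose (h : IsSymmPair A B) (hR : OddPair A B R R₁) :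
    OddPair A B Rᵀ R₁ᵀ := by
  rw [h.oddPair_iff] at hR ⊢
  have h1 := h.evenPair_transpose hR
  have h2 : ∀ M : Matrix ι ι ℂ, (A ⊙ M)ᵀ = A ⊙ Mᵀ := by
    intro M
    ext i j
    simp [h.symm.apply i j]
  rwa [h2, h2] at h1

/-- Dualising the two product identities gives the same symmetric eigenvalue matrix `n B⁽⁻⁾ B⁽⁻⁾ᵀ`
for both components. This correction factor makes odd times odd even. -/
theorem evenPair_schurInv (h : IsSymmPair A B) :
    EvenPair A B (schurInv A ⊙ schurInv A) (schurInv A ⊙ schurInv A) := by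
  have hs : (schurInv A ⊙ schurInv A)ᵀ = schurInv A ⊙ schurInv A := by
    ext i j
    simp [schurInv_apply, h.symm.apply i j]
  have h1 := h.left.isEigMatrix_dual h.eig_mul_transpose
  rw [h.symm, hs] at h1
  have h2 := h.right.transpose.transpose.isEigMatrix_dual
    (h.transpose.eig_mul_transpose_right)
  rw [hs] at h2
  simp only [Matrix.transpose_transpose, schurInv_transpose] at h2
  refine ⟨_, h1, ?_⟩
  rw [Matrix.transpose_smul, Matrix.transpose_mul, Matrix.transpose_transpose, schurInv_transpose]
  exact h2

theorem evenPair_of_oddPair_hadamard (h : IsSymmPair A B) (hR : OddPair A B R R₁)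
    (hR' : OddPair A B R' R₁') : EvenPair A B (R ⊙ R') (R₁ ⊙ R₁') := by
  rw [h.oddPair_iff] at hR hR'
  have h1 := h.evenPair_hadamard h.evenPair_schurInv (h.evenPair_hadamard hR hR')
  have h2 : ∀ M N : Matrix ι ι ℂ, (schurInv A ⊙ schurInv A) ⊙ ((A ⊙ M) ⊙ (A ⊙ N)) = M ⊙ N := by
    intro M N
    ext i j
    have := h.left.ne_zero i j
    simp only [Matrix.hadamard_apply, schurInv_apply]
    field_simp
  rwa [h2, h2] at h1

theorem oddPair_hadamard (h : IsSymmPair A B) (hF : EvenPair A B F G)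
    (hR : OddPair A B R R₁) : OddPair A B (F ⊙ R) (G ⊙ R₁) := by
  rw [h.oddPair_iff] at hR ⊢
  have h1 := h.evenPair_hadamard hF hR
  have h2 : ∀ M N : Matrix ι ι ℂ, M ⊙ (A ⊙ N) = A ⊙ (M ⊙ N) := by
    intro M N
    ext i j
    simp only [Matrix.hadamard_apply]
    ring
  rwa [h2, h2] at h1

/-- The eigenvalues of an even pair on the eigenvectors of `N_B` and `N_A`. -/
theorem evenPair_dual (h : IsSymmPair A B) (hF : EvenPair A B F G) :
    ∃ θ, IsEigMatrix B (schurInv B) F θᵀ ∧ IsEigMatrix A (schurInv A) G θ := by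
  obtain ⟨θ', h2⟩ : ∃ θ', IsEigMatrix Bᵀ (schurInv Bᵀ) G θ' := by
    obtain ⟨θ, -, h2⟩ := hF
    exact ⟨_, h2⟩
  -- Since `N_{Bᵀ} ⊆ N_A`, `G` is in `N_A`; then `F B = B G` transports its eigenvectors to those of
  -- `N_B`.
  obtain ⟨θ, h3⟩ := h.exists_eig_of_eig_transpose h2
  refine ⟨θ, h.eig_conj_symm h3 ?_, h3⟩
  rw [(h.evenPair_iff.1 hF).2, Matrix.mul_assoc,
    Matrix.mul_nonsing_inv_cancel_left _ _ h.isUnit_det]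

/-- Transpose twice: once within odd pairs, once by the rule that transposing a matrix inverts its
eigenvectors entrywise. -/
theorem oddPair_dual (h : IsSymmPair A B) (hR : OddPair A B R R₁) :
    ∃ ρ, IsEigMatrix (schurInv A) (schurInv B) R ρ ∧ IsEigMatrix A Bᵀ R₁ ρᵀ := by
  obtain ⟨ρ, h1, h2⟩ := h.oddPair_transpose hR
  refine ⟨ρ, ?_, ?_⟩
  · simpa using h.left.isEigMatrix_transpose_schurInv h.right.ne_zero h1
  · have := h.left.inv.isEigMatrix_transpose_schurInv h.right.transpose.inv.ne_zero h2
    simpa [schurInv_schurInv] using this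

theorem mul_allOnes_of_isEigMatrix {C M S : Matrix ι ι ℂ} (hC : IsTypeII C)
    (hM : IsEigMatrix C (schurInv C) M S) (i : ι) :
    M * allOnes ι = S i i • allOnes ι ∧ allOnes ι * M = S i i • allOnes ι := by
  have h1 : ∀ {N T : Matrix ι ι ℂ}, IsEigMatrix C (schurInv C) N T → ∀ y, ∑ z, N y z = T i i := by
    intro N T hN y
    have := hN i i y
    simpa [schurInv_apply, mul_inv_cancel₀ (hC.ne_zero _ i)] using this
  constructor
  · ext x y
    simpa [Matrix.mul_apply, allOnes] using h1 hM x
  · ext x y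
    simpa [Matrix.mul_apply, allOnes] using h1 (hC.isEigMatrix_transpose hM) y

/-- `A e_i ∘ A⁽⁻⁾ e_i` is the all-ones vector, and `θ` and `θᵀ` share their diagonal. The common
value of `c` is what makes block matrices commute with `Ĵ`. -/
theorem evenPair_mul_allOnes (h : IsSymmPair A B) (hF : EvenPair A B F G) :
    ∃ c : ℂ, (F * allOnes ι = c • allOnes ι ∧ allOnes ι * F = c • allOnes ι) ∧
      G * allOnes ι = c • allOnes ι ∧ allOnes ι * G = c • allOnes ι := by
  obtain ⟨θ, h1, h2⟩ := hF
  let i := Classical.arbitrary ι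
  exact ⟨θ i i, mul_allOnes_of_isEigMatrix h.left h1 i,
    mul_allOnes_of_isEigMatrix h.right.transpose h2 i⟩

theorem evenPair_comm (h : IsSymmPair A B) (hF : EvenPair A B F G) (hF' : EvenPair A B F' G') :
    F * F' = F' * F ∧ G * G' = G' * G := by
  obtain ⟨θ, h1, h2⟩ := hF
  obtain ⟨θ', h1', h2'⟩ := hF'
  exact ⟨h.left.commute_of_isEigMatrix h.left.inv.ne_zero h1 h1',
    h.right.transpose.commute_of_isEigMatrix h.right.transpose.inv.ne_zero h2 h2'⟩

theorem oddPair_comm (h : IsSymmPair A B) (hR : OddPair A B R R₁) (hR' : OddPair A B R' R₁') :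
    R * R' = R' * R ∧ R₁ * R₁' = R₁' * R₁ := by
  obtain ⟨θ, h1, h2⟩ := hR
  obtain ⟨θ', h1', h2'⟩ := hR'
  exact ⟨h.left.commute_of_isEigMatrix h.right.ne_zero h1 h1',
    h.left.inv.commute_of_isEigMatrix h.right.transpose.inv.ne_zero h2 h2'⟩

theorem mem_hatS_iff (h : IsSymmPair A B) {Z : Matrix (Four ι) (Four ι) ℂ} :
    Z ∈ hatS A B ↔ ∃ F G R R₁, EvenPair A B F G ∧ OddPair A B R R₁ ∧ Z = blockMatrix F R G R₁ := by
  constructor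
  · rintro ⟨F, R, R₁, hF, -, hR₁, hR, hθ, rfl⟩
    refine ⟨F, _, R, R₁, h.evenPair_iff.2 ⟨hF, rfl⟩, h.oddPair_iff.2 ?_, rfl⟩
    obtain ⟨θ, h1⟩ := mem_nomuraPair_iff.1 hR
    obtain ⟨θ₁, h2⟩ := mem_nomuraPair_iff.1 hR₁
    have h3 : theta Bᵀ (A ⊙ R₁) = θ₁ :=
      h2.eigMatrix_eq h.right.transpose.ne_zero h.right.transpose.inv.ne_zero
    have h4 : theta A (A ⊙ R) = θ := h1.eigMatrix_eq h.left.ne_zero h.left.inv.ne_zero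
    rw [h3, h4] at hθ
    refine ⟨θ, h1, ?_⟩
    rw [← hθ, Matrix.transpose_transpose]
    exact h2
  · rintro ⟨F, G, R, R₁, hF, hR, rfl⟩
    obtain ⟨hF', rfl⟩ := h.evenPair_iff.1 hF
    obtain ⟨θ, h1, h2⟩ := h.oddPair_iff.1 hR
    refine ⟨F, R, R₁, hF', ?_, mem_nomuraPair_iff.2 ⟨_, h2⟩, mem_nomuraPair_iff.2 ⟨_, h1⟩, ?_, rfl⟩
    · obtain ⟨ρ, h3, -⟩ := hR
      exact mem_nomuraPair_iff.2 ⟨ρ, h3⟩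
    · have h3 : theta Bᵀ (A ⊙ R₁) = θᵀ :=
        h2.eigMatrix_eq h.right.transpose.ne_zero h.right.transpose.inv.ne_zero
      have h4 : theta A (A ⊙ R) = θ := h1.eigMatrix_eq h.left.ne_zero h.left.inv.ne_zero
      rw [h3, h4, Matrix.transpose_transpose]

end IsSymmPair

end JonesPair

/-! ### Block matrix calculus, the dimension and the Bose–Mesner property. -/

namespace JonesPair

open Matrix

section Block

variable {ι : Type*} (F G R R₁ F' G' R' R₁' : Matrix ι ι ℂ)

theorem blockMatrix_add :
    blockMatrix F R G R₁ + blockMatrix F' R' G' R₁' =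
      blockMatrix (F + F') (R + R') (G + G') (R₁ + R₁') := by
  ext ((i | i) | (i | i)) ((j | j) | (j | j)) <;> simp [blockMatrix] <;> ring

theorem smul_blockMatrix (c : ℂ) :
    c • blockMatrix F R G R₁ = blockMatrix (c • F) (c • R) (c • G) (c • R₁) := by
  ext ((i | i) | (i | i)) ((j | j) | (j | j)) <;> simp [blockMatrix] <;> ring

theorem blockMatrix_transpose :
    (blockMatrix F R G R₁)ᵀ = blockMatrix Fᵀ Rᵀ Gᵀ R₁ᵀ := by
  ext ((i | i) | (i | i)) ((j | j) | (j | j)) <;> simp [blockMatrix]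

theorem blockMatrix_hadamard :
    blockMatrix F R G R₁ ⊙ blockMatrix F' R' G' R₁' =
      blockMatrix (F ⊙ F' + R ⊙ R') (F ⊙ R' + F' ⊙ R) (G ⊙ G' + R₁ ⊙ R₁')
        (G ⊙ R₁' + G' ⊙ R₁) := by
  ext ((i | i) | (i | i)) ((j | j) | (j | j)) <;> simp [blockMatrix] <;> ring

theorem blockMatrix_mul [Fintype ι] :
    blockMatrix F R G R₁ * blockMatrix F' R' G' R₁' =
      blockMatrix ((2 : ℂ) • (F * F')) ((2 : ℂ) • (R * R')) ((2 : ℂ) • (G * G'))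
        ((2 : ℂ) • (R₁ * R₁')) := by
  simp only [blockMatrix, fromBlocks_multiply, Matrix.mul_zero, Matrix.zero_mul, add_zero,
    zero_add, two_smul]
  congr 1 <;> congr 1 <;> noncomm_ring

theorem blockMatrix_injective (h : blockMatrix F R G R₁ = blockMatrix F' R' G' R₁') :
    F = F' ∧ R = R' := by
  simp only [blockMatrix, fromBlocks_inj] at h
  obtain ⟨⟨h1, h2, -, -⟩, -⟩ := h
  constructor
  · ext i j
    have e1 := congrFun (congrFun h1 i) j
    have e2 := congrFun (congrFun h2 i) j
    simp only [Matrix.add_apply, Matrix.sub_apply] at e1 e2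
    linear_combination (e1 + e2) / 2
  · ext i j
    have e1 := congrFun (congrFun h1 i) j
    have e2 := congrFun (congrFun h2 i) j
    simp only [Matrix.add_apply, Matrix.sub_apply] at e1 e2
    linear_combination (e1 - e2) / 2

theorem blockMatrix_hadamard_hatJ : blockMatrix F R G R₁ ⊙ hatJ ι = 0 := by
  ext ((i | i) | (i | i)) ((j | j) | (j | j)) <;> simp [blockMatrix, hatJ]

theorem hatJ_hadamard_self : hatJ ι ⊙ hatJ ι = hatJ ι := by
  ext ((i | i) | (i | i)) ((j | j) | (j | j)) <;> simp [hatJ, allOnes]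

theorem hatJ_transpose : (hatJ ι)ᵀ = hatJ ι := by
  ext ((i | i) | (i | i)) ((j | j) | (j | j)) <;> simp [hatJ, allOnes]

theorem allOnes_sum :
    allOnes (ι ⊕ ι) = fromBlocks (allOnes ι) (allOnes ι) (allOnes ι) (allOnes ι) := by
  ext (i | i) (j | j) <;> simp [allOnes]

theorem allOnes_four :
    allOnes (Four ι) = blockMatrix (allOnes ι) 0 (allOnes ι) 0 + hatJ ι := by
  ext ((i | i) | (i | i)) ((j | j) | (j | j)) <;> simp [allOnes, blockMatrix, hatJ]

theorem one_eq_blockMatrix [DecidableEq ι] :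
    (1 : Matrix (Four ι) (Four ι) ℂ) = (1 / 2 : ℂ) • blockMatrix 1 1 1 1 := by
  ext ((i | i) | (i | i)) ((j | j) | (j | j)) <;>
    simp [blockMatrix, Matrix.one_apply] <;> split_ifs <;> norm_num

variable {F G} in
theorem blockMatrix_mul_hatJ [Fintype ι] {c : ℂ} (hF : F * allOnes ι = c • allOnes ι)
    (hG : G * allOnes ι = c • allOnes ι) :
    blockMatrix F R G R₁ * hatJ ι = (2 * c) • hatJ ι := by
  have key : ∀ {F R : Matrix ι ι ℂ}, F * allOnes ι = c • allOnes ι →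
      (F + R) * allOnes ι + (F - R) * allOnes ι = (2 * c) • allOnes ι ∧
      (F - R) * allOnes ι + (F + R) * allOnes ι = (2 * c) • allOnes ι := by
    intro F R hF
    constructor
    · rw [mul_smul, ← hF, two_smul]; noncomm_ring
    · rw [mul_smul, ← hF, two_smul]; noncomm_ring
  simp only [hatJ, blockMatrix, allOnes_sum, fromBlocks_multiply, fromBlocks_smul,
    Matrix.mul_zero, Matrix.zero_mul, add_zero, zero_add, smul_zero, key hF, key hG]

variable {F G} in
theorem hatJ_mul_blockMatrix [Fintype ι] {c : ℂ} (hF : allOnes ι * F = c • allOnes ι)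
    (hG : allOnes ι * G = c • allOnes ι) :
    hatJ ι * blockMatrix F R G R₁ = (2 * c) • hatJ ι := by
  have key : ∀ {F R : Matrix ι ι ℂ}, allOnes ι * F = c • allOnes ι →
      allOnes ι * (F + R) + allOnes ι * (F - R) = (2 * c) • allOnes ι ∧
      allOnes ι * (F - R) + allOnes ι * (F + R) = (2 * c) • allOnes ι := by
    intro F R hF
    constructor
    · rw [mul_smul, ← hF, two_smul]; noncomm_ring
    · rw [mul_smul, ← hF, two_smul]; noncomm_ring
  simp only [hatJ, blockMatrix, allOnes_sum, fromBlocks_multiply, fromBlocks_smul,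
    Matrix.mul_zero, Matrix.zero_mul, add_zero, zero_add, smul_zero, key hF, key hG]

theorem hatJ_mul_self [Fintype ι] :
    hatJ ι * hatJ ι =
      (2 * (Fintype.card ι : ℂ)) • blockMatrix (allOnes ι) 0 (allOnes ι) 0 := by
  have h1 : allOnes ι * allOnes ι = (Fintype.card ι : ℂ) • allOnes ι := by
    ext i j
    simp [Matrix.mul_apply, allOnes]
  simp only [hatJ, blockMatrix, allOnes_sum, fromBlocks_multiply, fromBlocks_smul,
    Matrix.mul_zero, Matrix.zero_mul, add_zero, zero_add, smul_zero, sub_zero, h1, mul_smul,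
    two_smul, fromBlocks_add]

end Block

variable {ι : Type*} [Fintype ι] [DecidableEq ι] {A B : Matrix ι ι ℂ}

/-- The parametrization of the span of `Ŝ ∪ {Ĵ}`. -/
noncomputable def hatParam (A B : Matrix ι ι ℂ) :
    (nomura A × nomura A) × ℂ →ₗ[ℂ] Matrix (Four ι) (Four ι) ℂ where
  toFun p := blockMatrix p.1.1 (schurInv A ⊙ p.1.2) (B⁻¹ * p.1.1 * B)
    (schurInv A ⊙ (B⁻¹ * p.1.2 * B)) + p.2 • hatJ ι
  map_add' p q := by
    simp only [Prod.fst_add, Prod.snd_add, Submodule.coe_add, Matrix.hadamard_add,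
      Matrix.mul_add, Matrix.add_mul, ← blockMatrix_add, add_smul]
    abel
  map_smul' c p := by
    simp only [Prod.smul_fst, Prod.smul_snd, Submodule.coe_smul, Matrix.hadamard_smul,
      Matrix.mul_smul, Matrix.smul_mul, ← smul_blockMatrix, smul_assoc, smul_add,
      RingHom.id_apply]

namespace IsSymmPair

variable [Nonempty ι]

theorem mem_range_hatParam_iff (h : IsSymmPair A B) {Z : Matrix (Four ι) (Four ι) ℂ} :
    Z ∈ LinearMap.range (hatParam A B) ↔ ∃ F G R R₁, ∃ c : ℂ, EvenPair A B F G ∧ OddPair A B R R₁ ∧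
      Z = blockMatrix F R G R₁ + c • hatJ ι := by
  constructor
  · rintro ⟨⟨⟨F, K⟩, c⟩, rfl⟩
    exact ⟨F, _, _, _, c, h.evenPair_iff.2 ⟨F.2, rfl⟩,
      h.oddPair_of_evenPair (h.evenPair_iff.2 ⟨K.2, rfl⟩), rfl⟩
  · rintro ⟨F, G, R, R₁, c, hF, hR, rfl⟩
    obtain ⟨hF', rfl⟩ := h.evenPair_iff.1 hF
    obtain ⟨hK, hK₁⟩ := h.evenPair_iff.1 (h.oddPair_iff.1 hR)
    refine ⟨((⟨F, hF'⟩, ⟨A ⊙ R, hK⟩), c), ?_⟩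
    simp only [hatParam, LinearMap.coe_mk, AddHom.coe_mk]
    rw [← hK₁, h.schurInv_hadamard_cancel, h.schurInv_hadamard_cancel]

theorem spanHat_eq_range (h : IsSymmPair A B) :
    spanHat A B = LinearMap.range (hatParam A B) := by
  have h0 : EvenPair A B 0 0 := by simpa using EvenPair.one.smul (A := A) (B := B) 0
  apply le_antisymm
  · refine Submodule.span_le.2 (Set.union_subset ?_ ?_)
    · intro Z hZ
      obtain ⟨F, G, R, R₁, hF, hR, rfl⟩ := h.mem_hatS_iff.1 hZ
      exact h.mem_range_hatParam_iff.2 ⟨F, G, R, R₁, 0, hF, hR, by simp⟩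
    · rintro _ rfl
      refine h.mem_range_hatParam_iff.2 ⟨0, 0, 0, 0, 1, h0, OddPair.zero, ?_⟩
      simp [blockMatrix]
  · intro Z hZ
    obtain ⟨F, G, R, R₁, c, hF, hR, rfl⟩ := h.mem_range_hatParam_iff.1 hZ
    exact Submodule.add_mem _
      (Submodule.subset_span (Or.inl (h.mem_hatS_iff.2 ⟨F, G, R, R₁, hF, hR, rfl⟩)))
      (Submodule.smul_mem _ _ (Submodule.subset_span (Or.inr rfl)))

theorem mem_spanHat_iff (h : IsSymmPair A B) {Z : Matrix (Four ι) (Four ι) ℂ} :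
    Z ∈ spanHat A B ↔ ∃ F G R R₁, ∃ c : ℂ, EvenPair A B F G ∧ OddPair A B R R₁ ∧
      Z = blockMatrix F R G R₁ + c • hatJ ι := by
  rw [h.spanHat_eq_range, h.mem_range_hatParam_iff]

/-- An off-diagonal block shows `c`, the upper diagonal block shows `F` and `R`, and `K = A ∘ R`. -/
theorem hatParam_injective (h : IsSymmPair A B) : Function.Injective (hatParam A B) := by
  rw [injective_iff_map_eq_zero]
  rintro ⟨⟨F, K⟩, c⟩ h0
  have h0' : blockMatrix F (schurInv A ⊙ K) (B⁻¹ * F * B) (schurInv A ⊙ (B⁻¹ * K * B)) +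
    c • hatJ ι = 0 := h0
  let x := Classical.arbitrary ι
  have hc : c = 0 := by
    have h1 := congrFun (congrFun h0' (Sum.inl (Sum.inl x))) (Sum.inr (Sum.inl x))
    simpa [blockMatrix, hatJ, allOnes] using h1
  subst hc
  rw [zero_smul, add_zero] at h0'
  have hb : blockMatrix (0 : Matrix ι ι ℂ) 0 0 0 = 0 := by simp [blockMatrix]
  obtain ⟨h1, h2⟩ := blockMatrix_injective _ _ _ _ 0 0 0 0 (h0'.trans hb.symm)
  have h3 : (K : Matrix ι ι ℂ) = 0 := by
    rw [← h.hadamard_schurInv_cancel K, h2, Matrix.hadamard_zero]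
  simp only [Prod.mk_eq_zero, and_true]
  exact ⟨Subtype.ext h1, Subtype.ext h3⟩

theorem finrank_spanHat (h : IsSymmPair A B) :
    Module.finrank ℂ (spanHat A B) = 2 * Module.finrank ℂ (nomura A) + 1 := by
  rw [h.spanHat_eq_range, LinearMap.finrank_range_of_inj h.hatParam_injective,
    Module.finrank_prod, Module.finrank_prod, Module.finrank_self, two_mul]

theorem isBoseMesnerAlgebra_spanHat (h : IsSymmPair A B) :
    IsBoseMesnerAlgebra (spanHat A B) := by
  apply isBoseMesnerAlgebra_of_closed
  · exact h.mem_spanHat_iff.2 ⟨_, _, _, _, 0, EvenPair.one.smul (1 / 2), OddPair.one.smul (1 / 2),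
      by rw [one_eq_blockMatrix, smul_blockMatrix, zero_smul, add_zero]⟩
  · exact h.mem_spanHat_iff.2 ⟨_, _, _, _, 1, h.evenPair_allOnes, OddPair.zero,
      by rw [allOnes_four, one_smul]⟩
  · intro M hM N hN
    obtain ⟨F, G, R, R₁, c, hF, hR, rfl⟩ := h.mem_spanHat_iff.1 hM
    obtain ⟨F', G', R', R₁', c', hF', hR', rfl⟩ := h.mem_spanHat_iff.1 hN
    refine h.mem_spanHat_iff.2 ⟨_, _, _, _, c * c',
      (h.evenPair_hadamard hF hF').add (h.evenPair_of_oddPair_hadamard hR hR'),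
      (h.oddPair_hadamard hF hR').add (h.oddPair_hadamard hF' hR), ?_⟩
    rw [← blockMatrix_hadamard, Matrix.add_hadamard, Matrix.hadamard_add, Matrix.hadamard_add,
      Matrix.hadamard_smul, Matrix.smul_hadamard, Matrix.smul_hadamard, Matrix.hadamard_smul,
      hatJ_hadamard_self, Matrix.hadamard_comm (hatJ ι), blockMatrix_hadamard_hatJ,
      blockMatrix_hadamard_hatJ, smul_smul]
    simp
  · intro M hM N hN
    obtain ⟨F, G, R, R₁, c, hF, hR, rfl⟩ := h.mem_spanHat_iff.1 hM
    obtain ⟨F', G', R', R₁', c', hF', hR', rfl⟩ := h.mem_spanHat_iff.1 hN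
    obtain ⟨a, ⟨h1, -⟩, h2, -⟩ := h.evenPair_mul_allOnes hF
    obtain ⟨a', ⟨-, h3⟩, -, h4⟩ := h.evenPair_mul_allOnes hF'
    refine h.mem_spanHat_iff.2 ⟨_, _, _, _, c' * (2 * a) + c * (2 * a'),
      ((hF.mul hF').smul 2).add (h.evenPair_allOnes.smul (c * c' * (2 * Fintype.card ι))),
      ((hR.mul hR').smul 2).add (OddPair.zero.smul (c * c' * (2 * Fintype.card ι))), ?_⟩
    rw [← blockMatrix_add, ← blockMatrix_mul, ← smul_blockMatrix, Matrix.add_mul, Matrix.mul_add,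
      Matrix.mul_add, Matrix.mul_smul, Matrix.smul_mul, Matrix.smul_mul, Matrix.mul_smul,
      blockMatrix_mul_hatJ R R₁ h1 h2, hatJ_mul_blockMatrix R' R₁' h3 h4, hatJ_mul_self]
    module
  · intro M hM
    obtain ⟨F, G, R, R₁, c, hF, hR, rfl⟩ := h.mem_spanHat_iff.1 hM
    refine h.mem_spanHat_iff.2 ⟨_, _, _, _, c, h.evenPair_transpose hF, h.oddPair_transpose hR, ?_⟩
    rw [Matrix.transpose_add, Matrix.transpose_smul, hatJ_transpose, blockMatrix_transpose]
  · intro M hM N hN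
    obtain ⟨F, G, R, R₁, c, hF, hR, rfl⟩ := h.mem_spanHat_iff.1 hM
    obtain ⟨F', G', R', R₁', c', hF', hR', rfl⟩ := h.mem_spanHat_iff.1 hN
    obtain ⟨a, ⟨h1, h1'⟩, h2, h2'⟩ := h.evenPair_mul_allOnes hF
    obtain ⟨a', ⟨h3, h3'⟩, h4, h4'⟩ := h.evenPair_mul_allOnes hF'
    have h5 : blockMatrix F R G R₁ * blockMatrix F' R' G' R₁' =
        blockMatrix F' R' G' R₁' * blockMatrix F R G R₁ := by
      rw [blockMatrix_mul, blockMatrix_mul, (h.evenPair_comm hF hF').1,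
        (h.evenPair_comm hF hF').2, (h.oddPair_comm hR hR').1, (h.oddPair_comm hR hR').2]
    simp only [Matrix.add_mul, Matrix.mul_add, Matrix.mul_smul, Matrix.smul_mul, h5,
      blockMatrix_mul_hatJ _ _ h1 h2, hatJ_mul_blockMatrix _ _ h1' h2',
      blockMatrix_mul_hatJ _ _ h3 h4, hatJ_mul_blockMatrix _ _ h3' h4']
    module

end IsSymmPair

end JonesPair

/-! ### Eigenvectors of `N_V` and the inclusion in `N_V`. -/

namespace JonesPair

open Matrix

section MulVec

variable {ι : Type*} [Fintype ι]

/-- The vector with the four parts `f, e f, g, e g`. -/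
def fourVec (e : ℂ) (f g : ι → ℂ) : Four ι → ℂ :=
  Sum.elim (Sum.elim f (e • f)) (Sum.elim g (e • g))

theorem blockMatrix_mulVec_even {F G R R₁ : Matrix ι ι ℂ} {f g : ι → ℂ} {c : ℂ}
    (hf : F *ᵥ f = c • f) (hg : G *ᵥ g = c • g) (a b : ℂ) :
    blockMatrix F R G R₁ *ᵥ fourVec 1 (a • f) (b • g) =
      (2 * c) • fourVec 1 (a • f) (b • g) := by
  ext ((i | i) | (i | i)) <;>
    simp [blockMatrix, fourVec, fromBlocks_mulVec, add_mulVec, sub_mulVec, mulVec_smul, hf, hg] <;>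
    ring

theorem blockMatrix_mulVec_odd {F G R R₁ : Matrix ι ι ℂ} {f g : ι → ℂ} {c : ℂ}
    (hf : R *ᵥ f = c • f) (hg : R₁ *ᵥ g = c • g) (a b : ℂ) :
    blockMatrix F R G R₁ *ᵥ fourVec (-1) (a • f) (b • g) =
      (2 * c) • fourVec (-1) (a • f) (b • g) := by
  ext ((i | i) | (i | i)) <;>
    simp [blockMatrix, fourVec, fromBlocks_mulVec, add_mulVec, sub_mulVec, mulVec_smul,
      mulVec_neg, hf, hg] <;>
    ring

theorem hatJ_mulVec_fourVec (e : ℂ) (f g : ι → ℂ) :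
    hatJ ι *ᵥ fourVec e f g =
      Sum.elim (fun _ => (1 + e) * ∑ y, g y) (fun _ => (1 + e) * ∑ y, f y) := by
  ext ((i | i) | (i | i)) <;>
    simp [hatJ, fourVec, mulVec, dotProduct, allOnes, add_mul,
      Finset.mul_sum, Finset.sum_add_distrib]

end MulVec

variable {ι : Type*}

/-- The sign attached to a position in a pair of groups of columns. -/
def sgn (p : ι ⊕ ι) : ℂ := Sum.elim (fun _ => 1) (fun _ => -1) p

theorem sgn_mul_self (p : ι ⊕ ι) : sgn p * sgn p = 1 := by
  rcases p with i | i <;> simp [sgn]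

theorem sgn_mul_sgn_mul_self (p q : ι ⊕ ι) : sgn p * sgn q * (sgn p * sgn q) = 1 := by
  linear_combination sgn_mul_self p + (sgn p * sgn p) * sgn_mul_self q

/-- The position inside its group. -/
def pos (p : ι ⊕ ι) : ι := Sum.elim id id p

variable {A B : Matrix ι ι ℂ} {d : ℂ} (p q : ι ⊕ ι)

/-- Within one half of the columns the factor `d` cancels and the signs multiply to a common `±1`,
so the vector is of type `(f, f, g, g)`. Across the halves one sign survives in each part, which
gives type `(f, -f, g, -g)`. -/
theorem evec_matV_inl_inl (hd : d ≠ 0) :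
    evec (matV d A B) (schurInv (matV d A B)) (Sum.inl p) (Sum.inl q) =
      fourVec 1 ((sgn p * sgn q) • evec A (schurInv A) (pos p) (pos q))
        ((1 : ℂ) • evec Bᵀ (schurInv Bᵀ) (pos q) (pos p)) := by
  ext ((y | y) | (y | y)) <;> rcases p with i | i <;> rcases q with j | j <;>
    simp [evec, matV, fourVec, sgn, pos, schurInv_apply] <;> field_simp

theorem evec_matV_inr_inr (hd : d ≠ 0) :
    evec (matV d A B) (schurInv (matV d A B)) (Sum.inr p) (Sum.inr q) =
      fourVec 1 ((1 : ℂ) • evec B (schurInv B) (pos q) (pos p))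
        ((sgn p * sgn q) • evec A (schurInv A) (pos p) (pos q)) := by
  ext ((y | y) | (y | y)) <;> rcases p with i | i <;> rcases q with j | j <;>
    simp [evec, matV, fourVec, sgn, pos, schurInv_apply] <;> field_simp

theorem evec_matV_inl_inr :
    evec (matV d A B) (schurInv (matV d A B)) (Sum.inl p) (Sum.inr q) =
      fourVec (-1) ((sgn p * d) • evec A B (pos p) (pos q))
        ((sgn q * d⁻¹) • evec (schurInv A) (schurInv Bᵀ) (pos q) (pos p)) := by
  ext ((y | y) | (y | y)) <;> rcases p with i | i <;> rcases q with j | j <;>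
    simp [evec, matV, fourVec, sgn, pos, schurInv_apply] <;> ring

theorem evec_matV_inr_inl :
    evec (matV d A B) (schurInv (matV d A B)) (Sum.inr p) (Sum.inl q) =
      fourVec (-1) ((sgn q * d⁻¹) • evec (schurInv A) (schurInv B) (pos q) (pos p))
        ((sgn p * d) • evec A Bᵀ (pos p) (pos q)) := by
  ext ((y | y) | (y | y)) <;> rcases p with i | i <;> rcases q with j | j <;>
    simp [evec, matV, fourVec, sgn, pos, schurInv_apply] <;> ring

variable [Fintype ι] [DecidableEq ι]

namespace IsTypeII

variable {C : Matrix ι ι ℂ}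

theorem evec_self (hC : IsTypeII C) (i : ι) : evec C (schurInv C) i i = 1 :=
  funext fun y => mul_inv_cancel₀ (hC.ne_zero y i)

theorem sum_evec [Nonempty ι] (hC : IsTypeII C) (i j : ι) :
    ∑ y, evec C (schurInv C) i j y = if i = j then (Fintype.card ι : ℂ) else 0 :=
  hC.sum_col i j

end IsTypeII

theorem exists_hatJ_mulVec_eq [Nonempty ι] {C D : Matrix ι ι ℂ} (hC : IsTypeII C)
    (hD : IsTypeII D) (i j : ι) {a b : ℂ} (ha : a * a = 1) (hb : b * b = 1) :
    ∃ c : ℂ, hatJ ι *ᵥ fourVec 1 (a • evec C (schurInv C) i j) (b • evec D (schurInv D) j i) =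
      c • fourVec 1 (a • evec C (schurInv C) i j) (b • evec D (schurInv D) j i) := by
  rw [hatJ_mulVec_fourVec]
  simp only [Pi.smul_apply, smul_eq_mul, ← Finset.mul_sum, hC.sum_evec, hD.sum_evec]
  by_cases hij : i = j
  · subst hij
    -- The vector is constant `a` on one half and `b` on the other, and `Ĵ` sends it to `2nb` and
    -- `2na`; `a² = b² = 1` makes this a multiple.
    refine ⟨2 * a * b * Fintype.card ι, ?_⟩
    rw [hC.evec_self, hD.evec_self]
    ext ((y | y) | (y | y)) <;> simp [fourVec]
    · linear_combination (-2 * b * Fintype.card ι : ℂ) * ha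
    · linear_combination (-2 * b * Fintype.card ι : ℂ) * ha
    · linear_combination (-2 * a * Fintype.card ι : ℂ) * hb
    · linear_combination (-2 * a * Fintype.card ι : ℂ) * hb
  · refine ⟨0, ?_⟩
    rw [if_neg hij, if_neg (Ne.symm hij)]
    ext ((y | y) | (y | y)) <;> simp

namespace IsSymmPair

variable [Nonempty ι]

theorem hatJ_mem_nomura (h : IsSymmPair A B) (hd : d ≠ 0) : hatJ ι ∈ nomura (matV d A B) := by
  rintro (p | p) (q | q)
  · rw [evec_matV_inl_inl p q hd]
    exact exists_hatJ_mulVec_eq h.left h.right.transpose _ _ (sgn_mul_sgn_mul_self p q) (one_mul 1)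
  · rw [evec_matV_inl_inr, hatJ_mulVec_fourVec]
    -- Parts `f, -f` and `g, -g` sum to zero, so `Ĵ` annihilates the vector.
    refine ⟨0, ?_⟩
    ext ((y | y) | (y | y)) <;> simp
  · rw [evec_matV_inr_inl, hatJ_mulVec_fourVec]
    refine ⟨0, ?_⟩
    ext ((y | y) | (y | y)) <;> simp
  · rw [evec_matV_inr_inr p q hd]
    exact exists_hatJ_mulVec_eq h.right h.left _ _ (one_mul 1) (sgn_mul_sgn_mul_self p q)

theorem blockMatrix_mem_nomura (h : IsSymmPair A B) (hd : d ≠ 0) {F G R R₁ : Matrix ι ι ℂ}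
    (hF : EvenPair A B F G) (hR : OddPair A B R R₁) :
    blockMatrix F R G R₁ ∈ nomura (matV d A B) := by
  rintro (p | p) (q | q)
  · rw [evec_matV_inl_inl p q hd]
    obtain ⟨θ, h1, h2⟩ := hF
    exact ⟨_, blockMatrix_mulVec_even (isEigMatrix_iff_mulVec.1 h1 _ _)
      (isEigMatrix_iff_mulVec.1 h2 _ _) _ _⟩
  · rw [evec_matV_inl_inr]
    obtain ⟨ρ, h1, h2⟩ := hR
    exact ⟨_, blockMatrix_mulVec_odd (isEigMatrix_iff_mulVec.1 h1 _ _)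
      (isEigMatrix_iff_mulVec.1 h2 _ _) _ _⟩
  · rw [evec_matV_inr_inl]
    obtain ⟨ρ, h1, h2⟩ := h.oddPair_dual hR
    exact ⟨_, blockMatrix_mulVec_odd (isEigMatrix_iff_mulVec.1 h1 _ _)
      (isEigMatrix_iff_mulVec.1 h2 _ _) _ _⟩
  · rw [evec_matV_inr_inr p q hd]
    obtain ⟨θ, h1, h2⟩ := h.evenPair_dual hF
    exact ⟨_, blockMatrix_mulVec_even (isEigMatrix_iff_mulVec.1 h1 _ _)
      (isEigMatrix_iff_mulVec.1 h2 _ _) _ _⟩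

theorem spanHat_le_nomura (h : IsSymmPair A B) (hd : d ≠ 0) :
    spanHat A B ≤ nomura (matV d A B) := by
  intro Z hZ
  obtain ⟨F, G, R, R₁, c, hF, hR, rfl⟩ := h.mem_spanHat_iff.1 hZ
  exact Submodule.add_mem _ (h.blockMatrix_mem_nomura hd hF hR)
    (Submodule.smul_mem _ _ (h.hatJ_mem_nomura hd))

end IsSymmPair

end JonesPair

theorem mainTheorem9 (n : ℕ) (hn : 0 < n) (d : ℂ) (hd : d ^ 2 = (n : ℂ))
    (A B : Matrix (Fin n) (Fin n) ℂ) (hA : A.IsSymm)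
    (hAB : JonesPair.IsInvertibleJonesPair A B) :
    JonesPair.IsBoseMesnerAlgebra (JonesPair.spanHat A B) ∧
      JonesPair.spanHat A B ≤ JonesPair.nomura (JonesPair.matV d A B) ∧
      Module.finrank ℂ (JonesPair.spanHat A B) =
        2 * Module.finrank ℂ (JonesPair.nomura A) + 1 := by
  have : Nonempty (Fin n) := ⟨⟨0, hn⟩⟩
  have h := hAB.isSymmPair hA
  have hd0 : d ≠ 0 := by
    rintro rfl
    rw [zero_pow two_ne_zero] at hd
    exact hn.ne (by exact_mod_cast hd)
  exact ⟨h.isBoseMesnerAlgebra_spanHat, h.spanHat_le_nomura hd0, h.finrank_spanHat⟩
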